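/- Write $h_w(x)=\mathrm{sign}(w\cdot x)\in\{-1,+1\}$ for unit vectors $w\in\mathbb R^d$, $\theta(w,w')\in[0,\pi]$ for the angle, $\mathrm{err}_D(f)=\Pr_{(x,y)\sim D}[y\ne f(x)]$ for a distribution $D$ on $\mathbb R^d\times\{-1,+1\}$, $\mathrm{opt}=\inf_{\|w\|=1}\mathrm{err}_D(h_w)$, and $D_{w,\gamma}$ for $D$ conditioned on the band $|w\cdot x|\le\gamma$. A probability distribution on $\mathbb R^d$ is isotropic log-concave if it has a density $p$ with $\log p$ concave, mean $0$ and identity covariance. Call positive constants $\overline C_1,\underline C_1,\overline C_2,\underline C_2,C_3'$ valid if for every $d$, every isotropic log-concave $P$ on $\mathbb R^d$ and all unit vectors $w,w'$: (i) $\underline C_1\theta(w,w')\le \Pr_P[h_w\ne h_{w'}]\le \overline C_1\theta(w,w')$; (ii) $\Pr_P[|w\cdot x|\le\gamma]\le\overline C_2\gamma$ for all $\gamma\ge0$, and $\Pr_P[|w\cdot x|\le\gamma]\ge\underline C_2\gamma$ for $0\le\gamma\le1$; (iii) $\Pr_P[|w\cdot x|\ge C_3'\alpha,\ h_w\ne h_{w'}]\le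 \alpha\,\underline C_1/8$ whenever $\theta(w,w')\le\alpha<\pi/2$. Given valid constants put $c_0=\min\{\frac14,\frac{\underline C_1}{4\overline C_2C_3'}\}$, $c_\gamma=\max\{C_3',\underline C_1/\overline C_2\}$, $\alpha_k=2^{-k}\pi$, $\gamma_k=\alpha_kc_\gamma$, and, for $\varepsilon>0$, $r=\max\{0,\lceil\log_2(\overline C_1\pi/\varepsilon)\rceil-1\}$. An in-band oracle $\mathcal O$ on input $(w,\gamma,\alpha,\delta)$ takes $m(\gamma,\delta,\alpha)$ i.i.d. samples from $D$ and returns, measurably in its input, its samples and possibly internal randomness, a unit vector $w'$. Given $w^*$ and a tolerance function $g$, it meets its specification on $(w,\gamma,\alpha,\delta)$ if, whenever $\theta(w,w^*)\le\alpha$ and $\mathrm{err}_{D_{w,\gamma}}(h_{w^*})\le g(c_0)$, almost surely $\theta(w',w)\le\alpha$, and with probability at least $1-\delta$, $\Pr_{D_{w,\gamma}}[h_{w'}\ne h_{w^*}]\le c_0$. The localization algorithm starts with $w_1$, calls, for $k=1,\dots,r$, the oracle on $(w_k,\gamma_k,\alpha_k,\delta/r)$ with fresh samples to obtain $w_{k+1}$,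 and returns $w_{r+1}$. **Lemma (Margin-based localization).** Valid constants exist. Moreover, for any valid constants and any $g$ with $g(c_0)>0$ there is a constant $c>0$ (depending only on these) such that the following holds. Let $d\in\mathbb N$, let $D$ be a probability distribution on $\mathbb R^d\times\{-1,+1\}$ with isotropic log-concave marginal on $\mathbb R^d$, let $w^*$ be a unit vector with $\mathrm{err}_D(h_{w^*})=\mathrm{opt}$, let $\delta>0$, $\varepsilon>0$, $\varepsilon\ge c\cdot\mathrm{opt}$, let $w_1$ be a unit vector with $\theta(w_1,w^*)<\pi/2$, and let $\mathcal O$ be an oracle that meets its specification on all inputs $(w_k,\gamma_k,\alpha_k,\delta/r)$, $1\le k\le r$, that arise in the algorithm. Then the algorithm takes exactly $m=\sum_{k=1}^{r}m(\gamma_k,\delta/r,\alpha_k)$ samples from $D$, and with probability at least $1-\delta$ both $\theta(w_k,w^*)\le\alpha_k=2^{-k}\pi$ for all $1\le k\le r+1$ (each round halves the bound on the angle) and $\mathrm{err}_D(h_{w_{r+1}})\le\mathrm{opt}+\varepsilon$. -/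

import Mathlib

open MeasureTheory ProbabilityTheory InnerProductGeometry
open scoped RealInnerProductSpace

noncomputable section

namespace Localization

/-- The instance space `ℝᵈ`. -/
abbrev Space (d : ℕ) : Type := EuclideanSpace ℝ (Fin d)

/-- Unit vectors of `ℝᵈ`; they index the homogeneous linear thresholds. -/
abbrev UnitVec (d : ℕ) : Type := Metric.sphere (0 : Space d) 1

/-- A labeled instance; the label set `{-1, +1}` is `ℤˣ`. -/
abbrev Sample (d : ℕ) : Type := Space d × ℤˣ

/-- The angle `θ(w, w')` between two unit vectors, in `[0, π]`. -/
def theta {d : ℕ} (w w' : UnitVec d) : ℝ := angle (w : Space d) (w' : Space d)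

/-- The halfspace `h_w(x) = sign (w · x)`, with `sign 0 = +1`. -/
def halfspace {d : ℕ} (w : UnitVec d) (x : Space d) : ℤˣ :=
  if 0 ≤ ⟪(w : Space d), x⟫ then 1 else -1

/-- `err_D(f) = Pr_{(x,y) ∼ D}[y ≠ f x]`. -/
def err {d : ℕ} (D : Measure (Sample d)) (f : Space d → ℤˣ) : ℝ :=
  D.real {p | p.2 ≠ f p.1}

/-- `Pr_{(x,y) ∼ D}[f x ≠ f' x]`. -/
def disagreement {d : ℕ} (D : Measure (Sample d)) (f f' : Space d → ℤˣ) : ℝ :=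
  D.real {p | f p.1 ≠ f' p.1}

/-- The least error of a halfspace through the origin. -/
def opt {d : ℕ} (D : Measure (Sample d)) : ℝ :=
  ⨅ w : UnitVec d, err D (halfspace w)

/-- The distribution `D_{w,γ}` of labeled instances in the band `|w · x| ≤ γ`: the conditional
distribution of `D` given the band. -/
def bandDist {d : ℕ} (D : Measure (Sample d)) (w : UnitVec d) (γ : ℝ) : Measure (Sample d) :=
  D[|{p : Sample d | |⟪(w : Space d), p.1⟫| ≤ γ}]

/-- A probability distribution on `ℝᵈ` that has a density `p` with `log p` concave (as a function
with value `-∞` where `p` vanishes: its domain `{p > 0}` is convex and `log p` is concave there),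
mean zero and identity covariance matrix. -/
structure IsIsotropicLogConcave {d : ℕ} (P : Measure (Space d)) : Prop where
  isProbabilityMeasure : IsProbabilityMeasure P
  exists_density : ∃ p : Space d → ℝ, Measurable p ∧ (∀ x, 0 ≤ p x) ∧
    P = volume.withDensity (fun x => ENNReal.ofReal (p x)) ∧
    ConcaveOn ℝ {x | 0 < p x} (fun x => Real.log (p x))
  memLp : MemLp (fun x : Space d => x) 2 P
  mean : ∫ x, x ∂P = 0
  covariance : ∀ u v : Space d, ∫ x, ⟪u, x⟫ * ⟪v, x⟫ ∂P = ⟪u, v⟫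

/-- Five real numbers: `C1u`, `C1l` are the upper and lower constants for the probability of
disagreement of two halfspaces, `C2u`, `C2l` the ones for the probability of a band, and `C3'` is
the band width factor belonging to the tail constant `C₃ = C1l / 8`. -/
structure Constants where
  C1u : ℝ
  C1l : ℝ
  C2u : ℝ
  C2l : ℝ
  C3' : ℝ

/-- The constants are positive and are valid simultaneously for all isotropic log-concave
distributions in all dimensions. -/
structure Constants.Valid (C : Constants) : Prop where
  C1u_pos : 0 < C.C1u
  C1l_pos : 0 < C.C1l
  C2u_pos : 0 < C.C2u
  C2l_pos : 0 < C.C2l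
  C3'_pos : 0 < C.C3'
  angle_lower : ∀ (d : ℕ) (P : Measure (Space d)), IsIsotropicLogConcave P →
    ∀ w w' : UnitVec d, C.C1l * theta w w' ≤ P.real {x | halfspace w x ≠ halfspace w' x}
  angle_upper : ∀ (d : ℕ) (P : Measure (Space d)), IsIsotropicLogConcave P →
    ∀ w w' : UnitVec d, P.real {x | halfspace w x ≠ halfspace w' x} ≤ C.C1u * theta w w'
  band_lower : ∀ (d : ℕ) (P : Measure (Space d)), IsIsotropicLogConcave P →
    ∀ (w : UnitVec d) (γ : ℝ), 0 ≤ γ → γ ≤ 1 →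
      C.C2l * γ ≤ P.real {x | |⟪(w : Space d), x⟫| ≤ γ}
  band_upper : ∀ (d : ℕ) (P : Measure (Space d)), IsIsotropicLogConcave P →
    ∀ (w : UnitVec d) (γ : ℝ), 0 ≤ γ →
      P.real {x | |⟪(w : Space d), x⟫| ≤ γ} ≤ C.C2u * γ
  wedge : ∀ (d : ℕ) (P : Measure (Space d)), IsIsotropicLogConcave P →
    ∀ (w w' : UnitVec d) (α : ℝ), theta w w' ≤ α → α < Real.pi / 2 →
      P.real {x | C.C3' * α ≤ |⟪(w : Space d), x⟫| ∧ halfspace w x ≠ halfspace w' x}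
        ≤ α * (C.C1l / 8)

namespace Constants

/-- The disagreement `c₀` that the oracle has to reach in the band. -/
def c0 (C : Constants) : ℝ := min (1 / 4) (C.C1l / (4 * C.C2u * C.C3'))

/-- The factor `c_γ`. -/
def cGamma (C : Constants) : ℝ := max C.C3' (C.C1l / C.C2u)

/-- The number of rounds, `log₂ (C1u π / ε) - 1` with the logarithm rounded up to an integer;
it is zero if `C1u π / ε ≤ 2`. -/
def rounds (C : Constants) (ε : ℝ) : ℕ := ⌈Real.logb 2 (C.C1u * Real.pi / ε)⌉₊ - 1

end Constants

/-- The angle bound `α_k = 2⁻ᵏ π`. -/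
def alpha (k : ℕ) : ℝ := Real.pi / 2 ^ k

/-- The band width `γ_k = α_k c_γ`. -/
def Constants.gamma (C : Constants) (k : ℕ) : ℝ := alpha k * C.cGamma

/-- An in-band optimization oracle. On input `(w, γ, α, δ)` it takes `samples γ δ α` labeled
instances, may use internal randomness `u : Ω`, and returns a unit vector. -/
structure BandOracle (d : ℕ) (Ω : Type*) [MeasurableSpace Ω] where
  samples : ℝ → ℝ → ℝ → ℕ
  run : UnitVec d → (γ α δ : ℝ) → (Fin (samples γ δ α) → Sample d) → Ω → UnitVec d
  measurable_run : ∀ γ α δ : ℝ, Measurable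
    (fun q : UnitVec d × (Fin (samples γ δ α) → Sample d) × Ω => run q.1 γ α δ q.2.1 q.2.2)

namespace BandOracle

variable {d : ℕ} {Ω : Type*} [MeasurableSpace Ω]

/-- The oracle meets its post-conditions on the input `(w, γ, α, δ)`: if `θ(w, w*) ≤ α` and
`h_{w*}` has error at most `tol` in the band, then, over i.i.d. samples from `D` and internal
randomness of law `Q`, the returned `w'` satisfies `θ(w', w) ≤ α` and, with probability at least
`1 - δ`, `h_{w'}` and `h_{w*}` disagree with probability at most `c₀` in the band. -/
def MeetsSpec (O : BandOracle d Ω) (D : Measure (Sample d)) (Q : Measure Ω)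
    (wstar : UnitVec d) (c₀ tol : ℝ) (w : UnitVec d) (γ α δ : ℝ) : Prop :=
  theta w wstar ≤ α → err (bandDist D w γ) (halfspace wstar) ≤ tol →
    (∀ᵐ q ∂((Measure.pi fun _ : Fin (O.samples γ δ α) => D).prod Q),
      theta (O.run w γ α δ q.1 q.2) w ≤ α) ∧
    1 - δ ≤ ((Measure.pi fun _ : Fin (O.samples γ δ α) => D).prod Q).real
      {q | disagreement (bandDist D w γ) (halfspace (O.run w γ α δ q.1 q.2)) (halfspace wstar)
        ≤ c₀}

/-- Localization with an oracle, run on a stream `s` of samples and a stream `u` of internal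
random choices of the oracle. The value at `k` is the state after `k` rounds: the current vector
`w_{k+1}` and the number of samples taken so far. Round `k + 1` calls the oracle on
`(w_{k+1}, γ_{k+1}, α_{k+1}, δ / r)` with the next unused samples of the stream, where `r` is the
number of rounds. -/
def state (O : BandOracle d Ω) (C : Constants) (ε δ : ℝ) (w₁ : UnitVec d)
    (s : ℕ → Sample d) (u : ℕ → Ω) : ℕ → UnitVec d × ℕ
  | 0 => (w₁, 0)
  | k + 1 =>
    let st := O.state C ε δ w₁ s u k
    (O.run st.1 (C.gamma (k + 1)) (alpha (k + 1)) (δ / C.rounds ε)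
        (fun i => s (st.2 + i)) (u k),
      st.2 + O.samples (C.gamma (k + 1)) (δ / C.rounds ε) (alpha (k + 1)))

/-- The vector `w_k` of the algorithm, for `k ≥ 1`. -/
def iterate (O : BandOracle d Ω) (C : Constants) (ε δ : ℝ) (w₁ : UnitVec d)
    (s : ℕ → Sample d) (u : ℕ → Ω) (k : ℕ) : UnitVec d :=
  (O.state C ε δ w₁ s u (k - 1)).1

/-- The vector that the algorithm returns: the oracle's answer in the last round, `w_{r+1}`. -/
def output (O : BandOracle d Ω) (C : Constants) (ε δ : ℝ) (w₁ : UnitVec d)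
    (s : ℕ → Sample d) (u : ℕ → Ω) : UnitVec d :=
  (O.state C ε δ w₁ s u (C.rounds ε)).1

/-- The number of samples that the algorithm takes. -/
def samplesTaken (O : BandOracle d Ω) (C : Constants) (ε δ : ℝ) (w₁ : UnitVec d)
    (s : ℕ → Sample d) (u : ℕ → Ω) : ℕ :=
  (O.state C ε δ w₁ s u (C.rounds ε)).2

end BandOracle

end Localization

end

open Localization

open scoped ENNReal Pointwise Topology

/-! The statement has two independent halves: probabilistic constants uniform in the dimension, and
an induction on rounds.

Constants. Every quantity in the definition of validity depends on `x` only through one or two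
linear functionals. By Prékopa–Leindler, the marginals on lines and planes are again isotropic
log-concave, so uniform bounds on densities on `ℝ` and `ℂ` suffice. Such a density is bounded above:
if it were huge at a point, bounded line integrals would force it to halve within a tiny radius and
then decay exponentially, leaving too small a second moment (`exists_bound_of_line_integral`). It is
bounded below near `0`: if it were small at `a`, a hyperplane through `a` would bound a halfspace on
which the density is small, whereas mean zero and unit variance give every halfspace near the origin
a definite mass (`exists_density_lower`). In the plane it decays like `‖x‖⁻⁴`
(`exists_density_decay`). Two halfspaces disagree on a double wedge of the plane spanned by their
normals. Integrating the decay over the wedge gives the upper bound and the margin bound; a small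
box inside it gives the lower bound.

Induction. Let `w` be within `α` of the target. The new vector can disagree with the target in the
band, where the oracle controls it, or outside, where one of the two disagrees with `w` far from the
boundary of `w`. These parts contribute at most `C1l * α / 4` and twice `C1l * α / 8`, so the angle
lower bound turns the sum into an angle of at most `α / 2` (`Constants.Valid.theta_le_half`). The
oracle's precondition holds because in every executed round `ε < C1u * α_k`: the band has mass at
least of order `ε`, while the target errs with probability only `opt ≤ ε / c`. Fresh samples make
the oracle's guarantee applicable with the current vector frozen (`lintegral_next_round`), and a
union bound over the rounds costs `δ`. -/

namespace Localization

/-! ### The Prékopa–Leindler inequality -/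

section PrekopaLeindler

/-- The one-dimensional Brunn–Minkowski inequality. -/
theorem volume_add_volume_le {A B C : Set ℝ} (hA : MeasurableSet A) (hB : MeasurableSet B)
    (hA' : A.Nonempty) (hB' : B.Nonempty) (h : ∀ a ∈ A, ∀ b ∈ B, a + b ∈ C) :
    volume A + volume B ≤ volume C := by
  obtain ⟨a₀, ha₀⟩ := hA'
  obtain ⟨b₀, hb₀⟩ := hB'
  rw [hA.measure_eq_iSup_isCompact, hB.measure_eq_iSup_isCompact]
  simp only [iSup_and']
  refine ENNReal.biSup_add_biSup_le' ⟨∅, by simp⟩ ⟨∅, by simp⟩ ?_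
  rintro K ⟨hKA, hK⟩ L ⟨hLB, hL⟩
  -- Adding a point makes the compact sets nonempty, so that the extrema `M` and `m` exist.
  have hK' : IsCompact (insert a₀ K) := hK.insert a₀
  have hL' : IsCompact (insert b₀ L) := hL.insert b₀
  obtain ⟨M, hMK, hM⟩ := hK'.exists_isGreatest (Set.insert_nonempty _ _)
  obtain ⟨m, hmL, hm⟩ := hL'.exists_isLeast (Set.insert_nonempty _ _)
  have hKA' : insert a₀ K ⊆ A := Set.insert_subset ha₀ hKA
  have hLB' : insert b₀ L ⊆ B := Set.insert_subset hb₀ hLB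
  -- Both translates lie in `A + B`. One ends at `M + m`, where the other begins, so they overlap in
  -- at most one point and their volumes add.
  set K' : Set ℝ := (fun x => x + m) '' (insert a₀ K)
  set L' : Set ℝ := (fun x => M + x) '' (insert b₀ L)
  have vK : volume K' = volume (insert a₀ K) := by
    simp [K', Set.image_add_right, measure_preimage_add_right]
  have vL : volume L' = volume (insert b₀ L) := by
    simp [L', Set.image_add_left, measure_preimage_add]
  have hdisj : AEDisjoint volume K' L' := by
    refine measure_mono_null (t := {M + m}) ?_ (by simp)
    rintro x ⟨⟨a, ha, rfl⟩, ⟨b, hb, hab⟩⟩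
    have h1 := hM ha
    have h2 := hm hb
    simp only [Set.mem_singleton_iff] at *
    linarith
  have hLm : MeasurableSet L' :=
    (hL'.image (continuous_const.add continuous_id)).isClosed.measurableSet
  have key : volume K' + volume L' ≤ volume C := by
    rw [← measure_union₀ hLm.nullMeasurableSet hdisj]
    refine measure_mono (Set.union_subset ?_ ?_)
    · rintro _ ⟨a, ha, rfl⟩
      exact h a (hKA' ha) m (hLB' hmL)
    · rintro _ ⟨b, hb, rfl⟩
      exact h M (hKA' hMK) b (hLB' hb)
  rw [vK, vL] at key
  refine le_trans ?_ key
  gcongr <;> exact Set.subset_insert _ _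

/-- Layer cake formula for a function bounded by one. -/
theorem lintegral_eq_lintegral_meas_lt_of_le_one {f : ℝ → ℝ≥0∞} (hf : Measurable f)
    (h1 : ∀ x, f x ≤ 1) :
    ∫⁻ x, f x = ∫⁻ s in Set.Ioi (0 : ℝ), volume {x | ENNReal.ofReal s < f x} := by
  have hne : ∀ x, f x ≠ ∞ := fun x => ne_top_of_le_ne_top ENNReal.one_ne_top (h1 x)
  have := lintegral_eq_lintegral_meas_lt (volume : Measure ℝ) (f := fun x => (f x).toReal)
    (Filter.Eventually.of_forall fun x => ENNReal.toReal_nonneg) hf.ennreal_toReal.aemeasurable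
  simp only [ENNReal.ofReal_toReal (hne _)] at this
  rw [this]
  refine setLIntegral_congr_fun measurableSet_Ioi fun s hs => congrArg _ ?_
  ext x
  exact (ENNReal.ofReal_lt_iff_lt_toReal (le_of_lt hs) (hne x)).symm

theorem volume_combination_le {A B C : Set ℝ} {t : ℝ} (ht : t ∈ Set.Ioo (0 : ℝ) 1)
    (hA : MeasurableSet A) (hB : MeasurableSet B) (hA' : A.Nonempty) (hB' : B.Nonempty)
    (h : ∀ a ∈ A, ∀ b ∈ B, (1 - t) * a + t * b ∈ C) :
    ENNReal.ofReal (1 - t) * volume A + ENNReal.ofReal t * volume B ≤ volume C := by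
  have h1 : (0 : ℝ) < 1 - t := by linarith [ht.2]
  have e1 := Measure.addHaar_smul_of_nonneg volume h1.le A
  have e2 := Measure.addHaar_smul_of_nonneg volume ht.1.le B
  simp only [Module.finrank_self, pow_one] at e1 e2
  rw [← e1, ← e2]
  refine volume_add_volume_le (hA.const_smul₀ _) (hB.const_smul₀ _) hA'.smul_set hB'.smul_set ?_
  rintro _ ⟨a, ha, rfl⟩ _ ⟨b, hb, rfl⟩
  exact h a ha b hb

/-- The arithmetic form of the Prékopa–Leindler inequality on the line, for normalized
functions. -/
theorem lintegral_combination_le {f g h : ℝ → ℝ≥0∞} (hf : Measurable f) (hg : Measurable g)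
    (hh : Measurable h) {t : ℝ} (ht : t ∈ Set.Ioo (0 : ℝ) 1) (f1 : ⨆ x, f x = 1)
    (g1 : ⨆ x, g x = 1)
    (H : ∀ x y, f x ^ (1 - t) * g y ^ t ≤ h ((1 - t) * x + t * y)) :
    ENNReal.ofReal (1 - t) * (∫⁻ x, f x) + ENNReal.ofReal t * (∫⁻ x, g x) ≤ ∫⁻ x, h x := by
  have h1 : (0 : ℝ) < 1 - t := by linarith [ht.2]
  have hf1 : ∀ x, f x ≤ 1 := fun x => f1 ▸ le_iSup f x
  have hg1 : ∀ x, g x ≤ 1 := fun x => g1 ▸ le_iSup g x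
  have hhm : Measurable fun x => min (h x) 1 := hh.min measurable_const
  -- Cutting `h` at one is harmless: `f` and `g` have no superlevel sets above that level.
  calc _ ≤ ∫⁻ x, min (h x) 1 := ?_
    _ ≤ _ := lintegral_mono fun x => min_le_left _ _
  rw [lintegral_eq_lintegral_meas_lt_of_le_one hf hf1,
    lintegral_eq_lintegral_meas_lt_of_le_one hg hg1,
    lintegral_eq_lintegral_meas_lt_of_le_one hhm fun x => min_le_right _ _]
  have anti : ∀ φ : ℝ → ℝ≥0∞, Measurable fun s : ℝ => volume {x | ENNReal.ofReal s < φ x} := by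
    intro φ
    refine Antitone.measurable fun a b hab => measure_mono fun x hx => ?_
    exact lt_of_le_of_lt (ENNReal.ofReal_le_ofReal hab) hx
  rw [← lintegral_const_mul _ (anti f), ← lintegral_const_mul _ (anti g),
    ← lintegral_add_left ((anti f).const_mul _)]
  refine setLIntegral_mono (anti _) fun s hs => ?_
  -- Below level one both superlevel sets are nonempty, because the suprema equal one;
  -- Brunn–Minkowski needs this. From level one on they are empty.
  rcases lt_or_ge s 1 with hs1 | hs1
  · have hs1' : ENNReal.ofReal s < 1 := by
      rw [← ENNReal.ofReal_one]; exact (ENNReal.ofReal_lt_ofReal_iff one_pos).2 hs1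
    refine volume_combination_le ht (measurableSet_lt measurable_const hf)
      (measurableSet_lt measurable_const hg) ?_ ?_ ?_
    · exact lt_iSup_iff.1 (f1 ▸ hs1')
    · exact lt_iSup_iff.1 (g1 ▸ hs1')
    · intro a ha b hb
      refine lt_min (lt_of_lt_of_le ?_ (H a b)) hs1'
      have e : ENNReal.ofReal s = ENNReal.ofReal s ^ (1 - t) * ENNReal.ofReal s ^ t := by
        have hs0 : ENNReal.ofReal s ≠ 0 := by simpa using hs
        rw [← ENNReal.rpow_add _ _ hs0 ENNReal.ofReal_ne_top]
        simp
      rw [e]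
      exact ENNReal.mul_lt_mul (ENNReal.rpow_lt_rpow ha h1) (ENNReal.rpow_lt_rpow hb ht.1)
  · have e : ∀ φ : ℝ → ℝ≥0∞, (∀ x, φ x ≤ 1) → {x | ENNReal.ofReal s < φ x} = ∅ := by
      intro φ hφ
      ext x
      simp only [Set.mem_ofPred_eq, Set.mem_empty_iff_false, iff_false, not_lt]
      exact (hφ x).trans (ENNReal.one_le_ofReal.2 hs1)
    simp [e f hf1, e g hg1]

theorem geom_mean_le_arith_mean_ennreal (a b : ℝ≥0∞) {t : ℝ} (ht : t ∈ Set.Ioo (0 : ℝ) 1) :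
    a ^ (1 - t) * b ^ t ≤ ENNReal.ofReal (1 - t) * a + ENNReal.ofReal t * b := by
  have h1 : (0 : ℝ) < 1 - t := by linarith [ht.2]
  have hpq : (1 - t)⁻¹.HolderConjugate t⁻¹ := by
    rw [Real.holderConjugate_iff]
    refine ⟨(one_lt_inv₀ h1).2 (by linarith [ht.1]), by simp⟩
  have := ENNReal.young_inequality (a ^ (1 - t)) (b ^ t) hpq
  rw [← ENNReal.rpow_mul, ← ENNReal.rpow_mul, mul_inv_cancel₀ h1.ne', mul_inv_cancel₀ ht.1.ne',
    ENNReal.rpow_one, ENNReal.rpow_one, ENNReal.ofReal_inv_of_pos h1,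
    ENNReal.ofReal_inv_of_pos ht.1, div_eq_mul_inv, div_eq_mul_inv, inv_inv, inv_inv,
    mul_comm a, mul_comm b] at this
  exact this

/-- `E` with its volume satisfies the Prékopa–Leindler inequality. -/
def PrekopaLeindler (E : Type*) [AddCommGroup E] [Module ℝ E] [MeasureSpace E] : Prop :=
  ∀ f g h : E → ℝ≥0∞, Measurable f → Measurable g → Measurable h →
    ∀ t ∈ Set.Ioo (0 : ℝ) 1, (∀ x y, f x ^ (1 - t) * g y ^ t ≤ h ((1 - t) • x + t • y)) →
      (∫⁻ x, f x) ^ (1 - t) * (∫⁻ x, g x) ^ t ≤ ∫⁻ x, h x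

/-- Dividing `f`, `g`, `h` by `A`, `B`, `A ^ (1 - t) * B ^ t` normalizes the suprema and preserves
the hypothesis. The arithmetic form followed by the AM–GM inequality is then homogeneous enough to
scale back. -/
theorem lintegral_rpow_mul_le_of_bounded {f g h : ℝ → ℝ≥0∞} (hf : Measurable f) (hg : Measurable g)
    (hh : Measurable h) {t : ℝ} (ht : t ∈ Set.Ioo (0 : ℝ) 1) (f1 : ⨆ x, f x ≠ ∞)
    (g1 : ⨆ x, g x ≠ ∞) (H : ∀ x y, f x ^ (1 - t) * g y ^ t ≤ h ((1 - t) * x + t * y)) :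
    (∫⁻ x, f x) ^ (1 - t) * (∫⁻ x, g x) ^ t ≤ ∫⁻ x, h x := by
  have h1 : (0 : ℝ) < 1 - t := by linarith [ht.2]
  set A := ⨆ x, f x with hA
  set B := ⨆ x, g x with hB
  rcases eq_or_ne A 0 with hA0 | hA0
  · have : ∀ x, f x = 0 := fun x => le_antisymm (hA0 ▸ le_iSup f x) zero_le
    simp [this, h1]
  rcases eq_or_ne B 0 with hB0 | hB0
  · have : ∀ x, g x = 0 := fun x => le_antisymm (hB0 ▸ le_iSup g x) zero_le
    simp [this, ht.1]
  set c := A ^ (1 - t) * B ^ t with hc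
  have hA1 : A ^ (1 - t) ≠ 0 := by simp [hA0, f1]
  have hB1 : B ^ t ≠ 0 := by simp [hB0, g1]
  have hA2 : A ^ (1 - t) ≠ ∞ := ENNReal.rpow_ne_top_of_nonneg h1.le f1
  have hB2 : B ^ t ≠ ∞ := ENNReal.rpow_ne_top_of_nonneg ht.1.le g1
  have hc0 : c ≠ 0 := mul_ne_zero hA1 hB1
  have hc1 : c ≠ ∞ := ENNReal.mul_ne_top hA2 hB2
  have cinv : c⁻¹ = A⁻¹ ^ (1 - t) * B⁻¹ ^ t := by
    rw [hc, ENNReal.mul_inv (Or.inl hA1) (Or.inl hA2), ENNReal.inv_rpow, ENNReal.inv_rpow]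
  have key := lintegral_combination_le (f := fun x => A⁻¹ * f x) (g := fun x => B⁻¹ * g x)
    (h := fun x => c⁻¹ * h x) (hf.const_mul _) (hg.const_mul _) (hh.const_mul _) ht
    (by rw [← ENNReal.mul_iSup, ← hA, ENNReal.inv_mul_cancel hA0 f1])
    (by rw [← ENNReal.mul_iSup, ← hB, ENNReal.inv_mul_cancel hB0 g1])
    (by
      intro x y
      rw [ENNReal.mul_rpow_of_nonneg _ _ h1.le, ENNReal.mul_rpow_of_nonneg _ _ ht.1.le, cinv]
      calc _ = A⁻¹ ^ (1 - t) * B⁻¹ ^ t * (f x ^ (1 - t) * g y ^ t) := by ring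
        _ ≤ _ := by gcongr; exact H x y)
  replace key := (geom_mean_le_arith_mean_ennreal _ _ ht).trans key
  rw [lintegral_const_mul _ hf, lintegral_const_mul _ hg, lintegral_const_mul _ hh,
    ENNReal.mul_rpow_of_nonneg _ _ h1.le, ENNReal.mul_rpow_of_nonneg _ _ ht.1.le] at key
  have : c⁻¹ * ((∫⁻ x, f x) ^ (1 - t) * (∫⁻ x, g x) ^ t) ≤ c⁻¹ * ∫⁻ x, h x := by
    rw [cinv]
    calc _ = _ := by ring
      _ ≤ _ := key
      _ = _ := by rw [cinv]
  exact (ENNReal.mul_le_mul_iff_right (ENNReal.inv_ne_zero.2 hc1) (ENNReal.inv_ne_top.2 hc0)).1 this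

theorem tendsto_lintegral_min_natCast {α : Type*} [MeasurableSpace α] {μ : Measure α}
    {f : α → ℝ≥0∞} (hf : Measurable f) :
    Filter.Tendsto (fun n : ℕ => ∫⁻ x, min (f x) n ∂μ) Filter.atTop (𝓝 (∫⁻ x, f x ∂μ)) := by
  refine lintegral_tendsto_of_tendsto_of_monotone
    (fun n => (hf.min measurable_const).aemeasurable) ?_ ?_
  · exact Filter.Eventually.of_forall fun x m n hmn =>
      min_le_min_left _ (by exact_mod_cast hmn)
  · refine Filter.Eventually.of_forall fun x => ?_
    have : Filter.Tendsto (fun n : ℕ => min (f x) (n : ℝ≥0∞)) Filter.atTop (𝓝 (min (f x) ∞)) :=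
      tendsto_const_nhds.min ENNReal.tendsto_nat_nhds_top
    simpa using this

theorem prekopaLeindler_real : PrekopaLeindler ℝ := by
  intro f g h hf hg hh t ht H
  have h1 : (0 : ℝ) < 1 - t := by linarith [ht.2]
  -- Zero integrals are set aside because multiplication on `ℝ≥0∞` is discontinuous at `0 * ∞`,
  -- which would break the limit of truncations.
  rcases eq_or_ne (∫⁻ x, f x) 0 with hf0 | hf0
  · simp [hf0, h1]
  rcases eq_or_ne (∫⁻ x, g x) 0 with hg0 | hg0
  · simp [hg0, ht.1]
  have lim : Filter.Tendsto (fun n : ℕ => (∫⁻ x, min (f x) n) ^ (1 - t) *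
      (∫⁻ x, min (g x) n) ^ t) Filter.atTop
      (𝓝 ((∫⁻ x, f x) ^ (1 - t) * (∫⁻ x, g x) ^ t)) := by
    refine ENNReal.Tendsto.mul ((tendsto_lintegral_min_natCast hf).ennrpow_const _) (Or.inl ?_)
      ((tendsto_lintegral_min_natCast hg).ennrpow_const _) (Or.inl ?_)
    · simp [hf0, h1.not_gt]
    · simp [hg0, ht.1.not_gt]
  refine le_of_tendsto' lim fun n => ?_
  refine lintegral_rpow_mul_le_of_bounded (hf.min measurable_const) (hg.min measurable_const) hh ht
    ?_ ?_ ?_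
  · exact ne_top_of_le_ne_top (ENNReal.natCast_ne_top n) (iSup_le fun x => min_le_right _ _)
  · exact ne_top_of_le_ne_top (ENNReal.natCast_ne_top n) (iSup_le fun x => min_le_right _ _)
  · intro x y
    refine le_trans ?_ (H x y)
    gcongr
    · exact min_le_left _ _
    · exact ht.1.le
    · exact min_le_left _ _

/-- Tensorization: the inequality on the fibres `F` says exactly that the fibre integrals satisfy
the hypothesis of the inequality on `E`. -/
theorem PrekopaLeindler.prod {E F : Type*} [AddCommGroup E] [Module ℝ E] [MeasureSpace E]
    [AddCommGroup F] [Module ℝ F] [MeasureSpace F] [SFinite (volume : Measure E)]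
    [SFinite (volume : Measure F)] (hE : PrekopaLeindler E) (hF : PrekopaLeindler F) :
    PrekopaLeindler (E × F) := by
  intro f g h hf hg hh t ht H
  rw [Measure.volume_eq_prod, lintegral_prod _ hf.aemeasurable, lintegral_prod _ hg.aemeasurable,
    lintegral_prod _ hh.aemeasurable]
  refine hE _ _ _ hf.lintegral_prod_right' hg.lintegral_prod_right' hh.lintegral_prod_right' t ht ?_
  intro x y
  refine hF _ _ _ (hf.comp measurable_prodMk_left) (hg.comp measurable_prodMk_left)
    (hh.comp measurable_prodMk_left) t ht fun u v => ?_
  exact H (x, u) (y, v)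

theorem PrekopaLeindler.of_measurePreserving {E F : Type*} [AddCommGroup E] [Module ℝ E]
    [MeasureSpace E] [AddCommGroup F] [Module ℝ F] [MeasureSpace F] (hE : PrekopaLeindler E)
    (e : E →ₗ[ℝ] F) (he : MeasurePreserving e) : PrekopaLeindler F := by
  intro f g h hf hg hh t ht H
  rw [← he.lintegral_comp hf, ← he.lintegral_comp hg, ← he.lintegral_comp hh]
  refine hE _ _ _ (hf.comp he.measurable) (hg.comp he.measurable) (hh.comp he.measurable) t ht ?_
  intro x y
  simpa using H (e x) (e y)

theorem prekopaLeindler_pi (n : ℕ) : PrekopaLeindler (Fin n → ℝ) := by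
  induction n with
  | zero =>
    intro f g h _ _ _ t ht H
    have := H (Unique.instInhabited.default) (Unique.instInhabited.default)
    simp only [lintegral_unique, volume_pi, Measure.pi_empty_univ, mul_one]
    exact this.trans_eq (congrArg h (Subsingleton.elim _ _))
  | succ n ih =>
    refine (prekopaLeindler_real.prod ih).of_measurePreserving
      (Fin.consLinearEquiv ℝ (fun _ : Fin (n + 1) => ℝ)).toLinearMap ?_
    have : MeasurePreserving (fun p : ℝ × (Fin n → ℝ) => (Fin.cons p.1 p.2 : Fin (n + 1) → ℝ)) := by
      have := (volume_preserving_piFinSuccAbove (fun _ : Fin (n + 1) => ℝ) 0).symm _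
      simpa [MeasurableEquiv.piFinSuccAbove, Fin.insertNthEquiv] using this
    exact this

theorem prekopaLeindler_of_finiteDimensional (E : Type*) [NormedAddCommGroup E]
    [InnerProductSpace ℝ E] [FiniteDimensional ℝ E] [MeasurableSpace E] [BorelSpace E] :
    PrekopaLeindler E :=
  (prekopaLeindler_pi _).of_measurePreserving
    ((WithLp.linearEquiv 2 ℝ (Fin (Module.finrank ℝ E) → ℝ)).symm.trans
      (stdOrthonormalBasis ℝ E).repr.symm.toLinearEquiv).toLinearMap
    ((stdOrthonormalBasis ℝ E).measurePreserving_repr_symm.comp (PiLp.volume_preserving_toLp _))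

end PrekopaLeindler

/-! ### Isotropic log-concave densities and their marginals -/

section Marginals

open Module

/-- Log-concavity of a function with values in `[0, ∞]`. -/
def LogConcave {E : Type*} [AddCommGroup E] [Module ℝ E] (f : E → ℝ≥0∞) : Prop :=
  ∀ x y, ∀ t ∈ Set.Ioo (0 : ℝ) 1, f x ^ (1 - t) * f y ^ t ≤ f ((1 - t) • x + t • y)

/-- The measure `μ` is a probability measure with log-concave density `f`, mean zero and identity
covariance. -/
structure HasIsotropicDensity {E : Type*} [NormedAddCommGroup E] [InnerProductSpace ℝ E]
    [FiniteDimensional ℝ E] [MeasurableSpace E] [BorelSpace E] (μ : Measure E) (f : E → ℝ≥0∞) :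
    Prop where
  isProbabilityMeasure : IsProbabilityMeasure μ
  measurable : Measurable f
  logConcave : LogConcave f
  eq_withDensity : μ = volume.withDensity f
  memLp : MemLp (fun x : E => x) 2 μ
  mean : ∀ u : E, ∫ x, ⟪u, x⟫ ∂μ = 0
  covariance : ∀ u : E, ∫ x, ⟪u, x⟫ ^ 2 ∂μ = ‖u‖ ^ 2

/-- Off the support the multiplicative inequality is trivial, since a positive power of `0` is `0`;
on it, exponentiate concavity. -/
theorem logConcave_ofReal {E : Type*} [AddCommGroup E] [Module ℝ E] {p : E → ℝ}
    (hp : ConcaveOn ℝ {x | 0 < p x} (fun x => Real.log (p x))) :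
    LogConcave fun x => ENNReal.ofReal (p x) := by
  intro x y t ht
  have h1 : (0 : ℝ) < 1 - t := by linarith [ht.2]
  rcases le_or_gt (p x) 0 with hx | hx
  · simp [ENNReal.ofReal_of_nonpos hx, h1]
  rcases le_or_gt (p y) 0 with hy | hy
  · simp [ENNReal.ofReal_of_nonpos hy, ht.1]
  have hz : 0 < p ((1 - t) • x + t • y) := hp.1 hx hy h1.le ht.1.le (by ring)
  have key := hp.2 hx hy h1.le ht.1.le (by ring)
  rw [ENNReal.ofReal_rpow_of_pos hx, ENNReal.ofReal_rpow_of_pos hy,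
    ← ENNReal.ofReal_mul (Real.rpow_nonneg hx.le _)]
  refine ENNReal.ofReal_le_ofReal ?_
  rw [Real.rpow_def_of_pos hx, Real.rpow_def_of_pos hy, ← Real.exp_add, ← Real.le_log_iff_exp_le hz]
  simp only [smul_eq_mul] at key
  linarith

theorem IsIsotropicLogConcave.hasIsotropicDensity {d : ℕ} {P : Measure (Space d)}
    (hP : IsIsotropicLogConcave P) : ∃ f, HasIsotropicDensity P f := by
  obtain ⟨p, hpm, hp0, hPp, hpc⟩ := hP.exists_density
  have := hP.isProbabilityMeasure
  refine ⟨fun x => ENNReal.ofReal (p x), hP.isProbabilityMeasure, hpm.ennreal_ofReal,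
    logConcave_ofReal hpc, hPp, hP.memLp, fun u => ?_, fun u => ?_⟩
  · rw [integral_inner (hP.memLp.integrable (by norm_num)), hP.mean, inner_zero_right]
  · simpa [sq, real_inner_self_eq_norm_mul_norm] using hP.covariance u u

variable {A B E : Type*} [NormedAddCommGroup A] [InnerProductSpace ℝ A] [FiniteDimensional ℝ A]
  [MeasurableSpace A] [BorelSpace A] [NormedAddCommGroup B] [InnerProductSpace ℝ B]
  [FiniteDimensional ℝ B] [MeasurableSpace B] [BorelSpace B] [NormedAddCommGroup E]
  [InnerProductSpace ℝ E] [FiniteDimensional ℝ E] [MeasurableSpace E] [BorelSpace E]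

/-- By Pythagoras the map is a linear isometry for the `L²` norm on `A × B`, and that norm induces
the product volume. -/
theorem measurePreserving_add_of_orthogonal (J : A →ₗᵢ[ℝ] E) (N : B →ₗᵢ[ℝ] E)
    (horth : ∀ a b, ⟪J a, N b⟫ = 0) (hdim : finrank ℝ A + finrank ℝ B = finrank ℝ E) :
    MeasurePreserving (fun p : A × B => J p.1 + N p.2) := by
  let L : WithLp 2 (A × B) →ₗᵢ[ℝ] E :=
    { toLinearMap := (J.toLinearMap.coprod N.toLinearMap).comp
        (WithLp.linearEquiv 2 ℝ (A × B)).toLinearMap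
      norm_map' := by
        intro x
        have h : ‖J x.fst + N x.snd‖ ^ 2 = ‖x‖ ^ 2 := by
          rw [norm_add_sq_real, horth, J.norm_map, N.norm_map, WithLp.prod_norm_sq_eq_of_L2]
          ring
        exact (sq_eq_sq₀ (norm_nonneg _) (norm_nonneg _)).1 h }
  have hfin : finrank ℝ (WithLp 2 (A × B)) = finrank ℝ E := by
    rw [(WithLp.linearEquiv 2 ℝ (A × B)).finrank_eq, finrank_prod, hdim]
  exact (L.toLinearIsometryEquiv hfin).measurePreserving.comp (WithLp.volume_preserving_toLp A B)

/-- The marginal of an isotropic log-concave distribution on a subspace. -/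
theorem HasIsotropicDensity.marginal {μ : Measure E} {f : E → ℝ≥0∞} (h : HasIsotropicDensity μ f)
    (J : A →ₗᵢ[ℝ] E) (N : B →ₗᵢ[ℝ] E) (horth : ∀ a b, ⟪J a, N b⟫ = 0)
    (hdim : finrank ℝ A + finrank ℝ B = finrank ℝ E) (π : E →L[ℝ] A)
    (hπ : ∀ a x, ⟪a, π x⟫ = ⟪J a, x⟫) :
    HasIsotropicDensity (μ.map π) (fun a => ∫⁻ b, f (J a + N b)) := by
  have mp := measurePreserving_add_of_orthogonal J N horth hdim
  have hπm : Measurable π := π.continuous.measurable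
  have := h.isProbabilityMeasure
  have hπL : ∀ p : A × B, π (J p.1 + N p.2) = p.1 := by
    intro p
    refine ext_inner_left ℝ fun a => ?_
    rw [hπ, inner_add_right, horth, J.inner_map_map, add_zero]
  have hnorm : ∀ x, ‖π x‖ ≤ ‖x‖ := by
    intro x
    have h1 : ‖π x‖ * ‖π x‖ ≤ ‖π x‖ * ‖x‖ := by
      rw [← real_inner_self_eq_norm_mul_norm, hπ]
      exact (real_inner_le_norm _ _).trans_eq (by rw [J.norm_map])
    rcases (norm_nonneg (π x)).eq_or_lt with h0 | h0
    · rw [← h0]; exact norm_nonneg x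
    · exact le_of_mul_le_mul_left h1 h0
  have hfm : Measurable fun p : A × B => f (J p.1 + N p.2) := h.measurable.comp mp.measurable
  have int_map : ∀ g : A → ℝ, Continuous g → ∫ a, g a ∂(μ.map π) = ∫ x, g (π x) ∂μ :=
    fun g hg => integral_map hπm.aemeasurable hg.aestronglyMeasurable
  refine ⟨Measure.isProbabilityMeasure_map hπm.aemeasurable, hfm.lintegral_prod_right', ?_, ?_,
    ?_, ?_, ?_⟩
  · intro x y t ht
    -- Log-concavity of the marginal is Prékopa–Leindler applied to the fibres over `x`, `y` and
    -- their convex combination.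
    refine prekopaLeindler_of_finiteDimensional B _ _ _ (hfm.comp measurable_prodMk_left)
      (hfm.comp measurable_prodMk_left) (hfm.comp measurable_prodMk_left) t ht fun u v => ?_
    refine (h.logConcave _ _ t ht).trans_eq (congrArg f ?_)
    simp only [map_add, map_smul, smul_add]
    abel
  · ext s hs
    rw [Measure.map_apply hπm hs, withDensity_apply _ hs, h.eq_withDensity,
      withDensity_apply _ (hπm hs), ← lintegral_indicator (hπm hs), ← lintegral_indicator hs,
      ← mp.lintegral_comp (h.measurable.indicator (hπm hs)), Measure.volume_eq_prod,
      lintegral_prod (fun p : A × B => (π ⁻¹' s).indicator f (J p.1 + N p.2))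
        ((h.measurable.indicator (hπm hs)).comp mp.measurable).aemeasurable]
    refine lintegral_congr fun a => ?_
    by_cases ha : a ∈ s
    · rw [Set.indicator_of_mem ha]
      refine lintegral_congr fun b => Set.indicator_of_mem ?_ _
      simpa [hπL (a, b)] using ha
    · rw [Set.indicator_of_notMem ha]
      refine (lintegral_congr fun b => Set.indicator_of_notMem ?_ _).trans lintegral_zero
      simpa [hπL (a, b)] using ha
  · refine (memLp_map_measure_iff aestronglyMeasurable_id hπm.aemeasurable).2 ?_
    exact h.memLp.of_le π.continuous.aestronglyMeasurable (Filter.Eventually.of_forall hnorm)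
  · intro u
    rw [int_map _ (by fun_prop), ← h.mean (J u)]
    simp only [hπ]
  · intro u
    rw [int_map _ (by fun_prop), ← J.norm_map, ← h.covariance (J u)]
    simp only [hπ]

/-- The complementary isometry is the inclusion of the orthogonal complement of the range of `J`. -/
theorem HasIsotropicDensity.exists_marginal {μ : Measure E} {f : E → ℝ≥0∞}
    (h : HasIsotropicDensity μ f) (J : A →ₗᵢ[ℝ] E) (π : E →L[ℝ] A)
    (hπ : ∀ a x, ⟪a, π x⟫ = ⟪J a, x⟫) : ∃ g, HasIsotropicDensity (μ.map π) g := by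
  let K := (LinearMap.range J.toLinearMap)ᗮ
  refine ⟨_, h.marginal J K.subtypeₗᵢ ?_ ?_ π hπ⟩
  · rintro a ⟨b, hb⟩
    exact (Submodule.mem_orthogonal _ _).1 hb _ ⟨a, rfl⟩
  · rw [← LinearMap.finrank_range_of_inj J.injective]
    exact Submodule.finrank_add_finrank_orthogonal _

end Marginals

/-! ### Bounds on isotropic log-concave densities in low dimension -/

section DensityBounds

open Module

theorem LogConcave.le_of_le {E : Type*} [AddCommGroup E] [Module ℝ E] {f : E → ℝ≥0∞}
    (hf : LogConcave f) {a : ℝ≥0∞} {x y : E} (hx : a ≤ f x) (hy : a ≤ f y) {t : ℝ}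
    (ht : t ∈ Set.Ioo (0 : ℝ) 1) : a ≤ f ((1 - t) • x + t • y) := by
  have h1 : (0 : ℝ) < 1 - t := by linarith [ht.2]
  refine le_trans ?_ (hf x y t ht)
  calc a = a ^ (1 - t) * a ^ t := by
        rw [← ENNReal.rpow_add_of_nonneg _ _ h1.le ht.1.le]; simp
    _ ≤ _ := by gcongr; exact ht.1.le

theorem LogConcave.convex_lt {E : Type*} [AddCommGroup E] [Module ℝ E] {f : E → ℝ≥0∞}
    (hf : LogConcave f) (a : ℝ≥0∞) : Convex ℝ {x | a < f x} := by
  refine convex_iff_forall_pos.2 fun x hx y hy s t hs ht hst => ?_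
  have e : s = 1 - t := by linarith
  subst e
  exact lt_of_lt_of_le (lt_min hx hy)
    (hf.le_of_le (min_le_left _ _) (min_le_right _ _) ⟨ht, by linarith⟩)

theorem LogConcave.comp_add_left {E : Type*} [AddCommGroup E] [Module ℝ E] {f : E → ℝ≥0∞}
    (hf : LogConcave f) (a : E) : LogConcave fun x => f (a + x) := by
  intro x y t ht
  refine (hf _ _ t ht).trans_eq (congrArg f ?_)
  module

/-- A log-concave function that has dropped to a half on a sphere decays exponentially outside. -/
theorem LogConcave.le_rpow_of_le_half {E : Type*} [NormedAddCommGroup E] [NormedSpace ℝ E]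
    {f : E → ℝ≥0∞} (hf : LogConcave f) {M ρ : ℝ} (hM : 0 < M) (hρ : 0 < ρ)
    (h0 : ENNReal.ofReal M ≤ f 0) (h : ∀ v, ‖v‖ = ρ → f v ≤ ENNReal.ofReal (M / 2)) {y : E}
    (hy : ρ ≤ ‖y‖) : f y ≤ ENNReal.ofReal (M * (1 / 2) ^ (‖y‖ / ρ)) := by
  have hypos : 0 < ‖y‖ := hρ.trans_le hy
  rcases hy.eq_or_lt with hy' | hy'
  · rw [← hy', div_self hρ.ne', Real.rpow_one]
    exact (h y hy'.symm).trans_eq (by ring_nf)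
  -- `t • y` is the point of the segment from `0` to `y` on the sphere of radius `ρ`. Log-concavity
  -- bounds `f y` by the values at `0` and there.
  set t := ρ / ‖y‖ with ht
  have ht0 : 0 < t := by positivity
  have ht1 : t < 1 := (div_lt_one hypos).2 hy'
  have hs : ‖y‖ / ρ = t⁻¹ := by rw [ht, inv_div]
  have key : ENNReal.ofReal M ^ (1 - t) * f y ^ t ≤ ENNReal.ofReal (M / 2) := by
    calc _ ≤ f 0 ^ (1 - t) * f y ^ t := by gcongr
      _ ≤ f ((1 - t) • (0 : E) + t • y) := hf 0 y t ⟨ht0, ht1⟩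
      _ ≤ _ := h _ (by
        rw [smul_zero, zero_add, norm_smul, Real.norm_of_nonneg ht0.le, ht]; field_simp)
  have e : ENNReal.ofReal (M / 2) = ENNReal.ofReal M ^ (1 - t) *
      ENNReal.ofReal (M ^ t * (1 / 2)) := by
    rw [ENNReal.ofReal_rpow_of_pos hM, ← ENNReal.ofReal_mul (by positivity), ← mul_assoc,
      ← Real.rpow_add hM]
    norm_num
    ring_nf
  rw [e, ENNReal.mul_le_mul_iff_right (by simp [ENNReal.rpow_eq_zero_iff, hM])
    (ENNReal.rpow_ne_top_of_nonneg (by linarith) ENNReal.ofReal_ne_top)] at key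
  have := ENNReal.rpow_le_rpow key (z := t⁻¹) (by positivity)
  rw [← ENNReal.rpow_mul, mul_inv_cancel₀ ht0.ne', ENNReal.rpow_one,
    ENNReal.ofReal_rpow_of_pos (by positivity), Real.mul_rpow (by positivity) (by norm_num),
    ← Real.rpow_mul hM.le, mul_inv_cancel₀ ht0.ne', Real.rpow_one] at this
  rwa [hs]

/-- Replaces exponential decay by `(1 + ‖x‖) ^ (-3)`, which is integrable in dimensions below three.
It follows from `z ^ 5 / 5! ≤ exp z` at `z = (1 + s) * log 2`. -/
theorem exists_sq_mul_half_rpow_le :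
    ∃ K : ℝ, 0 < K ∧ ∀ s : ℝ, 0 ≤ s → s ^ 2 * (1 / 2 : ℝ) ^ s ≤ K * (1 + s) ^ (-3 : ℝ) := by
  have hl : 0 < Real.log 2 := Real.log_pos one_lt_two
  refine ⟨2 * (Nat.factorial 5 / Real.log 2 ^ 5), by positivity, fun s hs => ?_⟩
  have h1 : 0 < 1 + s := by linarith
  have key := Real.pow_div_factorial_le_exp ((1 + s) * Real.log 2) (by positivity) 5
  have e : Real.exp ((1 + s) * Real.log 2) * (1 / 2 : ℝ) ^ s = 2 := by
    rw [one_div, Real.inv_rpow (by norm_num), mul_comm (1 + s), ← Real.rpow_def_of_pos two_pos,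
      Real.rpow_add two_pos, Real.rpow_one, mul_assoc, mul_inv_cancel₀ (by positivity), mul_one]
  have hpos : 0 < (1 / 2 : ℝ) ^ s := by positivity
  have k2 := mul_le_mul_of_nonneg_right key hpos.le
  rw [e, mul_pow] at k2
  have e3 : (1 + s) ^ (-3 : ℝ) = ((1 + s) ^ 3)⁻¹ := by
    rw [Real.rpow_neg h1.le]; norm_cast
  rw [e3, ← div_eq_mul_inv, le_div_iff₀ (by positivity)]
  have k3 : (1 + s) ^ 5 * (1 / 2 : ℝ) ^ s ≤ 2 * (Nat.factorial 5 / Real.log 2 ^ 5) := by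
    have hf : (0 : ℝ) < Nat.factorial 5 := by positivity
    have hl5 : 0 < Real.log 2 ^ 5 := by positivity
    calc (1 + s) ^ 5 * (1 / 2 : ℝ) ^ s
        = ((1 + s) ^ 5 * Real.log 2 ^ 5 / Nat.factorial 5 * (1 / 2 : ℝ) ^ s) *
          (Nat.factorial 5 / Real.log 2 ^ 5) := by field_simp
      _ ≤ _ := by gcongr
  refine le_trans ?_ k3
  calc s ^ 2 * (1 / 2 : ℝ) ^ s * (1 + s) ^ 3 ≤ (1 + s) ^ 2 * (1 / 2 : ℝ) ^ s * (1 + s) ^ 3 := by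
        gcongr; linarith
    _ = _ := by ring

variable {E : Type*} [NormedAddCommGroup E] [InnerProductSpace ℝ E] [FiniteDimensional ℝ E]
  [MeasurableSpace E] [BorelSpace E]

/-- A log-concave probability density whose second moment is not small and whose integrals over
the lines through the origin are bounded is bounded at the origin. -/
theorem exists_bound_of_line_integral (E : Type*) [NormedAddCommGroup E] [InnerProductSpace ℝ E]
    [FiniteDimensional ℝ E] [MeasurableSpace E] [BorelSpace E] (h1 : 1 ≤ finrank ℝ E)
    (h3 : finrank ℝ E < 3) {C : ℝ} (hC : 0 < C) :
    ∃ M : ℝ, 0 < M ∧ ∀ f : E → ℝ≥0∞, Measurable f → LogConcave f → ∫⁻ x, f x = 1 →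
      1 ≤ ∫⁻ x, ENNReal.ofReal (‖x‖ ^ 2) * f x →
      (∀ v : E, ‖v‖ = 1 → ∫⁻ t : ℝ, f (t • v) ≤ ENNReal.ofReal C) → f 0 ≤ ENNReal.ofReal M := by
  obtain ⟨K, hK, hKs⟩ := exists_sq_mul_half_rpow_le
  set n := finrank ℝ E with hn
  set I := ∫ x : E, (1 + ‖x‖) ^ (-3 : ℝ) with hI
  have hint : Integrable fun x : E => (1 + ‖x‖) ^ (-3 : ℝ) :=
    integrable_one_add_norm (by exact_mod_cast h3)
  have hI0 : 0 ≤ I := integral_nonneg fun x => by positivity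
  -- `S` will bound `M ^ 2` times the second moment, so `M = 1 + S` contradicts a second moment of
  -- at least one.
  set S := 16 * C ^ 2 + K * I * (4 * C) ^ (n + 2) with hS
  have hS0 : 0 ≤ S := by positivity
  refine ⟨1 + S, by positivity, fun f hfm hf hf1 hf2 hline => ?_⟩
  by_contra! hlt
  set M := 1 + S with hMdef
  have hM : 0 < M := by positivity
  have hM1 : 1 ≤ M := by linarith
  -- If `f` exceeded `M / 2` at some point of norm `ρ`, it would be at least `M / 2` on the whole
  -- segment from the origin, and the line integral would be at least `M / 2 * ρ = 2 * C > C`.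
  set ρ := 4 * C / M with hρdef
  have hρ : 0 < ρ := by positivity
  have hhalf : ∀ v : E, ‖v‖ = ρ → f v ≤ ENNReal.ofReal (M / 2) := by
    intro v hv
    by_contra! hv'
    have hseg : ∀ t ∈ Set.Ioo 0 ρ, ENNReal.ofReal (M / 2) ≤ f (t • (ρ⁻¹ • v)) := by
      intro t ht
      have := hf.le_of_le (a := ENNReal.ofReal (M / 2)) (x := 0) (y := v)
        ((ENNReal.ofReal_le_ofReal (by linarith)).trans hlt.le) hv'.le (t := t / ρ)
        ⟨by have := ht.1; positivity, (div_lt_one hρ).2 ht.2⟩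
      simpa [smul_smul, div_eq_mul_inv] using this
    have h2 : ENNReal.ofReal (M / 2) * ENNReal.ofReal ρ ≤ ENNReal.ofReal C := by
      refine le_trans ?_ (hline (ρ⁻¹ • v) (by
        rw [norm_smul, hv, norm_inv, Real.norm_of_nonneg hρ.le, inv_mul_cancel₀ hρ.ne']))
      calc _ = ∫⁻ _ in Set.Ioo 0 ρ, ENNReal.ofReal (M / 2) := by simp
        _ ≤ ∫⁻ t in Set.Ioo 0 ρ, f (t • (ρ⁻¹ • v)) := setLIntegral_mono' measurableSet_Ioo hseg
        _ ≤ _ := setLIntegral_le_lintegral _ _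
    rw [← ENNReal.ofReal_mul (by positivity), ENNReal.ofReal_le_ofReal_iff hC.le] at h2
    have : M / 2 * ρ = 2 * C := by rw [hρdef]; field_simp; ring
    linarith
  have hpt : ∀ y : E, ENNReal.ofReal (‖y‖ ^ 2) * f y ≤ ENNReal.ofReal (ρ ^ 2) * f y +
      ENNReal.ofReal (M * ρ ^ 2 * K * (1 + ‖ρ⁻¹ • y‖) ^ (-3 : ℝ)) := by
    intro y
    rcases le_total ‖y‖ ρ with hy | hy
    · refine le_add_right ?_
      gcongr
    · refine le_add_left ?_
      calc _ ≤ ENNReal.ofReal (‖y‖ ^ 2) * ENNReal.ofReal (M * (1 / 2) ^ (‖y‖ / ρ)) := by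
            gcongr; exact hf.le_rpow_of_le_half hM hρ hlt.le hhalf hy
        _ = ENNReal.ofReal (‖y‖ ^ 2 * (M * (1 / 2) ^ (‖y‖ / ρ))) :=
            (ENNReal.ofReal_mul (by positivity)).symm
        _ ≤ _ := ENNReal.ofReal_le_ofReal ?_
      have e1 : ‖ρ⁻¹ • y‖ = ‖y‖ / ρ := by
        rw [norm_smul, norm_inv, Real.norm_of_nonneg hρ.le]; ring
      rw [e1]
      have := hKs (‖y‖ / ρ) (by positivity)
      calc _ = M * ρ ^ 2 * ((‖y‖ / ρ) ^ 2 * (1 / 2) ^ (‖y‖ / ρ)) := by field_simp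
        _ ≤ M * ρ ^ 2 * (K * (1 + ‖y‖ / ρ) ^ (-3 : ℝ)) := by gcongr
        _ = _ := by ring
  have hint' : Integrable fun y : E => M * ρ ^ 2 * K * (1 + ‖ρ⁻¹ • y‖) ^ (-3 : ℝ) :=
    (hint.comp_smul (inv_ne_zero hρ.ne')).const_mul _
  have htot := hf2.trans (lintegral_mono hpt)
  rw [lintegral_add_left (hfm.const_mul _), lintegral_const_mul _ hfm, hf1, mul_one,
    ← ofReal_integral_eq_lintegral_ofReal hint'
      (Filter.Eventually.of_forall fun y => by positivity), integral_const_mul,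
    Measure.integral_comp_inv_smul volume (fun y : E => (1 + ‖y‖) ^ (-3 : ℝ)) ρ,
    ← ENNReal.ofReal_add (by positivity) (by positivity), ENNReal.one_le_ofReal, smul_eq_mul,
    ← hI, ← hn, abs_of_nonneg (by positivity)] at htot
  -- Since `M * ρ = 4 * C` is fixed, the second summand equals a constant over `M ^ (n - 1)`; here
  -- `n ≥ 1` matters. With `htot` this yields `M ^ 2 ≤ S < M`.
  have e2 : M ^ 2 * (ρ ^ 2 + M * ρ ^ 2 * K * (ρ ^ n * I)) ≤ S := by
    have e3 : M ^ 2 * (ρ ^ 2 + M * ρ ^ 2 * K * (ρ ^ n * I)) =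
        (M * ρ) ^ 2 + K * I * ((M * ρ) ^ (n + 2) * M) / M ^ (n - 1) / M := by
      obtain ⟨k, hk⟩ : ∃ k, n = k + 1 := ⟨n - 1, by omega⟩
      rw [hk, Nat.add_sub_cancel, mul_pow M ρ (k + 1 + 2)]
      field_simp
      ring
    have e4 : M * ρ = 4 * C := by rw [hρdef]; field_simp
    rw [e3, e4, hS]
    have e5 : K * I * ((4 * C) ^ (n + 2) * M) / M ^ (n - 1) / M =
        K * I * (4 * C) ^ (n + 2) / M ^ (n - 1) := by field_simp
    rw [e5]
    have e6 : K * I * (4 * C) ^ (n + 2) / M ^ (n - 1) ≤ K * I * (4 * C) ^ (n + 2) :=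
      div_le_self (by positivity) (one_le_pow₀ hM1)
    nlinarith
  nlinarith [mul_le_mul_of_nonneg_left htot (sq_nonneg M)]

end DensityBounds

/-! ### Uniform bounds on isotropic densities and on the masses of bands and halfspaces -/

section IsotropicBounds

open Module

/-- A convex set lies, up to its frontier, on one side of a hyperplane through a point outside. -/
theorem exists_unit_inner_lt_of_convex {E : Type*} [NormedAddCommGroup E]
    [InnerProductSpace ℝ E] [FiniteDimensional ℝ E] [Nontrivial E] {S : Set E} (hS : Convex ℝ S) {a : E}
    (ha : a ∉ S) : ∃ u : E, ‖u‖ = 1 ∧ ∀ x ∈ interior S, ⟪u, a⟫ < ⟪u, x⟫ := by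
  rcases (interior S).eq_empty_or_nonempty with h0 | ⟨x₀, hx₀⟩
  · obtain ⟨u, hu⟩ := exists_norm_eq E zero_le_one
    exact ⟨u, hu, by simp [h0]⟩
  obtain ⟨g, hg⟩ := geometric_hahn_banach_open_point hS.interior isOpen_interior
    (fun h => ha (interior_subset h))
  set v := (InnerProductSpace.toDual ℝ E).symm g with hv
  have hvg : ∀ x, ⟪v, x⟫ = g x := fun x => InnerProductSpace.toDual_symm_apply
  have hv0 : v ≠ 0 := by
    intro h
    have := hg x₀ hx₀
    rw [← hvg, ← hvg, h] at this
    simp at this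
  refine ⟨-(‖v‖⁻¹ • v), by
    rw [norm_neg, norm_smul, norm_inv, norm_norm, inv_mul_cancel₀ (norm_ne_zero_iff.2 hv0)], fun x hx => ?_⟩
  have hpos : 0 < ‖v‖⁻¹ := inv_pos.2 (norm_pos_iff.2 hv0)
  rw [inner_neg_left, inner_neg_left, real_inner_smul_left, real_inner_smul_left, hvg, hvg]
  have := mul_lt_mul_of_pos_left (hg x hx) hpos
  linarith

variable {E : Type*} [NormedAddCommGroup E] [InnerProductSpace ℝ E] [FiniteDimensional ℝ E]
  [MeasurableSpace E] [BorelSpace E]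

namespace HasIsotropicDensity

variable {μ : Measure E} {f : E → ℝ≥0∞}

theorem lintegral_eq_one (h : HasIsotropicDensity μ f) : ∫⁻ x, f x = 1 := by
  have := h.isProbabilityMeasure
  have h1 := measure_univ (μ := μ)
  rwa [h.eq_withDensity, withDensity_apply _ MeasurableSet.univ, setLIntegral_univ] at h1

theorem memLp_inner (h : HasIsotropicDensity μ f) (u : E) : MemLp (fun x => ⟪u, x⟫) 2 μ :=
  h.memLp.const_inner u

theorem integrable_inner (h : HasIsotropicDensity μ f) (u : E) :
    Integrable (fun x => ⟪u, x⟫) μ :=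
  have := h.isProbabilityMeasure
  (h.memLp_inner u).integrable (by norm_num)

theorem integrable_inner_sq (h : HasIsotropicDensity μ f) (u : E) :
    Integrable (fun x => ⟪u, x⟫ ^ 2) μ :=
  (h.memLp_inner u).integrable_sq

/-- Chebyshev's inequality. -/
theorem measureReal_abs_inner_ge_le (h : HasIsotropicDensity μ f) {u : E} (hu : ‖u‖ = 1) {R : ℝ}
    (hR : 0 < R) : μ.real {x | R ≤ |⟪u, x⟫|} ≤ 1 / R ^ 2 := by
  have := mul_meas_ge_le_integral_of_nonneg (μ := μ) (f := fun x => ⟪u, x⟫ ^ 2)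
    (Filter.Eventually.of_forall fun x => sq_nonneg _) (h.integrable_inner_sq u) (R ^ 2)
  rw [h.covariance, hu] at this
  have e : {x | R ≤ |⟪u, x⟫|} = {x | R ^ 2 ≤ ⟪u, x⟫ ^ 2} := by
    ext x
    simp only [Set.mem_ofPred_eq]
    rw [← sq_abs ⟪u, x⟫, sq_le_sq₀ hR.le (abs_nonneg _)]
  rw [e, le_div_iff₀ (by positivity)]
  linarith

/-- Recentering away from the mean cannot lower the second moment: along a unit `u`, it is `1 + ⟪u,
a⟫ ^ 2`. -/
theorem one_le_lintegral_sq (h : HasIsotropicDensity μ f) [Nontrivial E] (a : E) :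
    1 ≤ ∫⁻ x, ENNReal.ofReal (‖x‖ ^ 2) * f (a + x) := by
  have := h.isProbabilityMeasure
  obtain ⟨u, hu⟩ := exists_norm_eq E zero_le_one
  have hm : Measurable fun x : E => ENNReal.ofReal (‖x - a‖ ^ 2) := by fun_prop
  have e : ∫⁻ x, ENNReal.ofReal (‖x‖ ^ 2) * f (a + x) = ∫⁻ x, ENNReal.ofReal (‖x - a‖ ^ 2) ∂μ := by
    rw [h.eq_withDensity, lintegral_withDensity_eq_lintegral_mul _ h.measurable hm]
    refine Eq.trans (lintegral_congr fun x => ?_)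
      (lintegral_add_left_eq_self (fun x => f x * ENNReal.ofReal (‖x - a‖ ^ 2)) a)
    simp [mul_comm]
  rw [e]
  have hint' : Integrable (fun x => ⟪u, x⟫ ^ 2 - 2 * ⟪u, a⟫ * ⟪u, x⟫) μ :=
    (h.integrable_inner_sq u).sub ((h.integrable_inner u).const_mul _)
  have hint : Integrable (fun x => ⟪u, x⟫ ^ 2 - 2 * ⟪u, a⟫ * ⟪u, x⟫ + ⟪u, a⟫ ^ 2) μ :=
    hint'.add (integrable_const _)
  have h1 : ∫ x, (⟪u, x⟫ ^ 2 - 2 * ⟪u, a⟫ * ⟪u, x⟫ + ⟪u, a⟫ ^ 2) ∂μ = 1 + ⟪u, a⟫ ^ 2 := by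
    rw [integral_add hint' (integrable_const _), integral_sub (h.integrable_inner_sq u)
      ((h.integrable_inner u).const_mul _), integral_const_mul, h.mean, h.covariance, hu]
    simp
  have hpt : ∀ x, ⟪u, x⟫ ^ 2 - 2 * ⟪u, a⟫ * ⟪u, x⟫ + ⟪u, a⟫ ^ 2 = ⟪u, x - a⟫ ^ 2 := by
    intro x; rw [inner_sub_right]; ring
  calc (1 : ℝ≥0∞) ≤ ENNReal.ofReal (1 + ⟪u, a⟫ ^ 2) :=
        ENNReal.one_le_ofReal.2 (by nlinarith [sq_nonneg ⟪u, a⟫])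
    _ = ∫⁻ x, ENNReal.ofReal (⟪u, x⟫ ^ 2 - 2 * ⟪u, a⟫ * ⟪u, x⟫ + ⟪u, a⟫ ^ 2) ∂μ := by
        rw [← h1, ofReal_integral_eq_lintegral_ofReal hint
          (Filter.Eventually.of_forall fun x => by simp only [hpt]; positivity)]
    _ ≤ _ := by
        refine lintegral_mono fun x => ENNReal.ofReal_le_ofReal ?_
        rw [hpt]
        have := abs_real_inner_le_norm u (x - a)
        rw [hu, one_mul] at this
        rw [← sq_abs]
        gcongr

/-- The one-dimensional marginal in a unit direction. -/
theorem exists_marginal_real (h : HasIsotropicDensity μ f) {u : E} (hu : ‖u‖ = 1) :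
    ∃ g, HasIsotropicDensity (μ.map fun x => ⟪u, x⟫) g := by
  refine h.exists_marginal (LinearIsometry.toSpanSingleton ℝ E hu) (innerSL ℝ u) fun a x => ?_
  simp [inner_smul_left, mul_comm]

end HasIsotropicDensity

/-- Bounded line integrals bound an isotropic log-concave density, in dimensions one and two. -/
theorem exists_density_bound_of_line_integral (E : Type*) [NormedAddCommGroup E]
    [InnerProductSpace ℝ E] [FiniteDimensional ℝ E] [MeasurableSpace E] [BorelSpace E]
    (h1 : 1 ≤ finrank ℝ E) (h3 : finrank ℝ E < 3) {C : ℝ} (hC : 0 < C) :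
    ∃ M : ℝ, 0 < M ∧ ∀ (μ : Measure E) (f : E → ℝ≥0∞), HasIsotropicDensity μ f → ∀ a : E,
      (∀ v : E, ‖v‖ = 1 → ∫⁻ t : ℝ, f (a + t • v) ≤ ENNReal.ofReal C) →
        f a ≤ ENNReal.ofReal M := by
  obtain ⟨M, hM, H⟩ := exists_bound_of_line_integral E h1 h3 hC
  have : Nontrivial E := Module.nontrivial_of_finrank_pos h1
  refine ⟨M, hM, fun μ f h a ha => ?_⟩
  have := H (fun x => f (a + x)) (h.measurable.comp (measurable_const_add a))
    (h.logConcave.comp_add_left a)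
    ((lintegral_add_left_eq_self f a).trans h.lintegral_eq_one) (h.one_le_lintegral_sq a) ha
  simpa using this

/-- A line in `ℝ` is all of `ℝ`, so every line integral is the total mass one. -/
theorem exists_density_bound_real :
    ∃ M : ℝ, 0 < M ∧ ∀ (μ : Measure ℝ) (f : ℝ → ℝ≥0∞), HasIsotropicDensity μ f → ∀ a,
      f a ≤ ENNReal.ofReal M := by
  obtain ⟨M, hM, H⟩ := exists_density_bound_of_line_integral ℝ (by simp) (by simp) one_pos
  refine ⟨M, hM, fun μ f h a => H μ f h a fun v hv => ?_⟩
  have e : ∫⁻ t : ℝ, f (a + t • v) = 1 := by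
    rcases (abs_eq zero_le_one).1 hv with rfl | rfl
    · simpa [h.lintegral_eq_one] using lintegral_add_left_eq_self (μ := volume) f a
    · simpa [h.lintegral_eq_one, ← sub_eq_add_neg] using lintegral_sub_left_eq_self (μ := volume) f a
  rw [e, ENNReal.ofReal_one]

/-- The marginal of a planar density in a unit direction is given by line integrals. -/
theorem HasIsotropicDensity.line_integral {μ : Measure ℂ} {f : ℂ → ℝ≥0∞}
    (h : HasIsotropicDensity μ f) {v : ℂ} (hv : ‖v‖ = 1) :
    HasIsotropicDensity (μ.map fun x => ⟪-Complex.I * v, x⟫)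
      (fun a : ℝ => ∫⁻ t : ℝ, f (a • (-Complex.I * v) + t • v)) := by
  have hw : ‖-Complex.I * v‖ = 1 := by simp [hv]
  have horth : ⟪-Complex.I * v, v⟫ = 0 := by
    simp [Complex.inner]; ring
  refine h.marginal (LinearIsometry.toSpanSingleton ℝ ℂ hw) (LinearIsometry.toSpanSingleton ℝ ℂ hv)
    ?_ ?_ (innerSL ℝ (-Complex.I * v)) ?_
  · intro a b
    rw [LinearIsometry.toSpanSingleton_apply, LinearIsometry.toSpanSingleton_apply,
      real_inner_smul_left, real_inner_smul_right, horth, mul_zero, mul_zero]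
  · simp [Complex.finrank_real_complex]
  · intro a x
    rw [LinearIsometry.toSpanSingleton_apply, real_inner_smul_left, innerSL_apply_apply]
    exact mul_comm _ _

/-- Line integrals of a planar density are values of one-dimensional marginal densities, which are
bounded by the case of `ℝ`. -/
theorem exists_density_bound_complex :
    ∃ M : ℝ, 0 < M ∧ ∀ (μ : Measure ℂ) (f : ℂ → ℝ≥0∞), HasIsotropicDensity μ f → ∀ a,
      f a ≤ ENNReal.ofReal M := by
  obtain ⟨C, hC, HC⟩ := exists_density_bound_real
  obtain ⟨M, hM, H⟩ := exists_density_bound_of_line_integral ℂ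
    (by simp [Complex.finrank_real_complex]) (by simp [Complex.finrank_real_complex]) hC
  refine ⟨M, hM, fun μ f h a => H μ f h a fun v hv => ?_⟩
  set w := -Complex.I * v with hw
  have hdecomp : a = ⟪w, a⟫ • w + ⟪v, a⟫ • v := by
    have hv2 : v.re * v.re + v.im * v.im = 1 := by
      rw [← Complex.normSq_apply, Complex.normSq_eq_norm_sq, hv, one_pow]
    apply Complex.ext
    · simp [Complex.inner, hw]
      linear_combination (-a.re) * hv2
    · simp [Complex.inner, hw]
      linear_combination (-a.im) * hv2
  have e : ∫⁻ t : ℝ, f (a + t • v) = ∫⁻ t : ℝ, f (⟪w, a⟫ • w + t • v) := by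
    rw [← lintegral_add_left_eq_self (fun t : ℝ => f (⟪w, a⟫ • w + t • v)) ⟪v, a⟫]
    refine lintegral_congr fun t => congrArg f ?_
    nth_rewrite 1 [hdecomp]
    module
  rw [e]
  exact HC _ _ (h.line_integral hv) ⟪w, a⟫

/-- Anti-concentration of a band. -/
theorem exists_band_upper :
    ∃ C : ℝ, 0 < C ∧ ∀ {E : Type} [NormedAddCommGroup E] [InnerProductSpace ℝ E]
      [FiniteDimensional ℝ E] [MeasurableSpace E] [BorelSpace E] (μ : Measure E) (f : E → ℝ≥0∞),
      HasIsotropicDensity μ f → ∀ u : E, ‖u‖ = 1 → ∀ γ, 0 ≤ γ →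
        μ.real {x | |⟪u, x⟫| ≤ γ} ≤ C * γ := by
  obtain ⟨M, hM, H⟩ := exists_density_bound_real
  refine ⟨2 * M, by positivity, ?_⟩
  intro E _ _ _ _ _ μ f h u hu γ hγ
  obtain ⟨g, hg⟩ := h.exists_marginal_real hu
  have hm : Measurable fun x : E => ⟪u, x⟫ := by fun_prop
  have hs : MeasurableSet {t : ℝ | |t| ≤ γ} := measurableSet_le (by fun_prop) measurable_const
  have e : μ {x | |⟪u, x⟫| ≤ γ} = (μ.map fun x => ⟪u, x⟫) {t | |t| ≤ γ} :=
    (Measure.map_apply hm hs).symm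
  have hset : {t : ℝ | |t| ≤ γ} = Set.Icc (-γ) γ := by ext t; simp [abs_le]
  have : μ {x | |⟪u, x⟫| ≤ γ} ≤ ENNReal.ofReal (2 * M * γ) := by
    rw [e, hg.eq_withDensity, withDensity_apply _ hs]
    calc _ ≤ ∫⁻ _ in {t : ℝ | |t| ≤ γ}, ENNReal.ofReal M := lintegral_mono fun t => H _ _ hg t
      _ = ENNReal.ofReal (2 * M * γ) := by
        rw [lintegral_const, Measure.restrict_apply_univ, hset, Real.volume_Icc,
          ← ENNReal.ofReal_mul hM.le]
        ring_nf
  exact ENNReal.toReal_le_of_le_ofReal (by positivity) this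

/-- A halfspace that is not far from the origin has mass bounded below. -/
theorem exists_halfspace_lower :
    ∃ r q : ℝ, 0 < r ∧ 0 < q ∧ ∀ {E : Type} [NormedAddCommGroup E] [InnerProductSpace ℝ E]
      [FiniteDimensional ℝ E] [MeasurableSpace E] [BorelSpace E] (μ : Measure E) (f : E → ℝ≥0∞),
      HasIsotropicDensity μ f → ∀ u : E, ‖u‖ = 1 → q ≤ μ.real {x | r < ⟪u, x⟫} := by
  obtain ⟨C, hC, H⟩ := exists_band_upper
  -- Chosen so that the band of half-width `2 * e` has mass at most `1 / 2`, whence the mean of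
  -- `|⟪u, x⟫|` is at least `e`.
  set e : ℝ := 1 / (4 * C) with he
  have he0 : 0 < e := by positivity
  refine ⟨e / 8, e ^ 2 / 8, by positivity, by positivity, ?_⟩
  intro E _ _ _ _ _ μ f h u hu
  have := h.isProbabilityMeasure
  have hm : Measurable fun x : E => ⟪u, x⟫ := by fun_prop
  have hband := H μ f h u hu (2 * e) (by positivity)
  have hC2 : C * (2 * e) = 1 / 2 := by rw [he]; field_simp; norm_num
  rw [hC2] at hband
  have hsm : MeasurableSet {x : E | |⟪u, x⟫| ≤ 2 * e} :=
    measurableSet_le (by fun_prop) measurable_const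
  have habs : e ≤ ∫ x, |⟪u, x⟫| ∂μ := by
    have h1 := mul_meas_ge_le_integral_of_nonneg (μ := μ) (f := fun x => |⟪u, x⟫|)
      (Filter.Eventually.of_forall fun x => abs_nonneg _) (h.integrable_inner u).abs (2 * e)
    have h2 : 1 / 2 ≤ μ.real {x | 2 * e ≤ |⟪u, x⟫|} := by
      have h3 := probReal_compl_eq_one_sub (μ := μ) hsm
      have h4 : μ.real {x : E | |⟪u, x⟫| ≤ 2 * e}ᶜ ≤ μ.real {x | 2 * e ≤ |⟪u, x⟫|} :=
        measureReal_mono fun x hx => by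
          simp only [Set.mem_compl_iff, Set.mem_ofPred_eq, not_le] at hx ⊢
          exact hx.le
      linarith
    nlinarith
  set T := {x : E | e / 8 < ⟪u, x⟫} with hT
  have hTm : MeasurableSet T := measurableSet_lt measurable_const hm
  -- This is `|X| = 2 X⁺ - X` with `X⁺ ≤ e / 8` off `T` and, by AM–GM, `X ≤ e / 8 * X ^ 2 + 2 / e`
  -- on `T`. Integrating with mean zero and variance one isolates the mass of `T`.
  have hpt : ∀ x : E, |⟪u, x⟫| ≤ 2 * (e / 8 + e / 8 * ⟪u, x⟫ ^ 2 +
      T.indicator (fun _ => 2 / e) x) - ⟪u, x⟫ := by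
    intro x
    set X := ⟪u, x⟫ with hX
    by_cases hx : x ∈ T
    · have hx' : e / 8 < X := hx
      rw [Set.indicator_of_mem hx, abs_of_pos (by linarith [he0])]
      have : 0 ≤ e / 8 * (X - 4 / e) ^ 2 := by positivity
      have e1 : e / 8 * (X - 4 / e) ^ 2 = e / 8 * X ^ 2 - X + 2 / e := by field_simp; ring
      linarith
    · have hx' : X ≤ e / 8 := not_lt.1 hx
      rw [Set.indicator_of_notMem hx]
      have : 0 ≤ e / 8 * X ^ 2 := by positivity
      rcases abs_cases X with ⟨h1, _⟩ | ⟨h1, _⟩ <;> rw [h1] <;> linarith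
  have hi1 : Integrable (fun _ : E => e / 8) μ := integrable_const _
  have hi2 : Integrable (fun x : E => e / 8 * ⟪u, x⟫ ^ 2) μ := (h.integrable_inner_sq u).const_mul _
  have hi3 : Integrable (T.indicator fun _ : E => 2 / e) μ := (integrable_const _).indicator hTm
  have hi4 : Integrable (fun x : E => e / 8 + e / 8 * ⟪u, x⟫ ^ 2) μ := hi1.add hi2
  have hi5 : Integrable (fun x : E => 2 * (e / 8 + e / 8 * ⟪u, x⟫ ^ 2 +
      T.indicator (fun _ => 2 / e) x)) μ := (hi4.add hi3).const_mul 2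
  have hint := integral_mono (h.integrable_inner u).abs (hi5.sub (h.integrable_inner u)) hpt
  have hval : ∫ x, (2 * (e / 8 + e / 8 * ⟪u, x⟫ ^ 2 + T.indicator (fun _ => 2 / e) x) - ⟪u, x⟫) ∂μ
      = 2 * (e / 8 + e / 8 + μ.real T * (2 / e)) := by
    rw [integral_sub hi5 (h.integrable_inner u),
      integral_const_mul, integral_add hi4 hi3, integral_add hi1 hi2,
      integral_const_mul, h.covariance, hu, h.mean, integral_indicator_const _ hTm]
    simp
  have hfin := habs.trans (hint.trans_eq hval)
  have e1 : μ.real T * (2 / e) = 2 * μ.real T / e := by ring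
  rw [e1] at hfin
  have : e / 4 ≤ 2 * μ.real T / e := by linarith
  rw [le_div_iff₀ he0] at this
  nlinarith

/-- Tail bound for the norm, uniform over isotropic distributions. -/
theorem exists_norm_tail (E : Type*) [NormedAddCommGroup E] [InnerProductSpace ℝ E]
    [FiniteDimensional ℝ E] [MeasurableSpace E] [BorelSpace E] :
    ∃ K : ℝ, 0 < K ∧ ∀ (μ : Measure E) (f : E → ℝ≥0∞), HasIsotropicDensity μ f → ∀ R, 0 < R →
      μ.real {x | R ≤ ‖x‖} ≤ K / R ^ 2 := by
  refine ⟨finrank ℝ E + 1, by positivity, fun μ f h R hR => ?_⟩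
  have := h.isProbabilityMeasure
  let b := stdOrthonormalBasis ℝ E
  have hb : ∀ i, Integrable (fun x => ⟪b i, x⟫ ^ 2) μ := fun i => h.integrable_inner_sq _
  have hx : ∀ x : E, ‖x‖ ^ 2 = ∑ i, ⟪b i, x⟫ ^ 2 := fun x => (b.sum_sq_inner_right x).symm
  have hsum : ∫ x, ‖x‖ ^ 2 ∂μ = finrank ℝ E := by
    simp_rw [hx]
    rw [integral_finsetSum _ fun i _ => hb i]
    simp [h.covariance, b.norm_eq_one]
  have hint : Integrable (fun x => ‖x‖ ^ 2) μ := by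
    simp_rw [hx]
    exact integrable_finsetSum _ fun i _ => hb i
  have := mul_meas_ge_le_integral_of_nonneg (μ := μ) (f := fun x : E => ‖x‖ ^ 2)
    (Filter.Eventually.of_forall fun x => sq_nonneg _) hint (R ^ 2)
  have e : {x : E | R ≤ ‖x‖} = {x | R ^ 2 ≤ ‖x‖ ^ 2} := by
    ext x
    simp only [Set.mem_ofPred_eq]
    rw [sq_le_sq₀ hR.le (norm_nonneg _)]
  rw [e, le_div_iff₀ (by positivity)]
  linarith

/-- An isotropic log-concave density is bounded below near the origin. -/
theorem exists_density_lower (E : Type) [NormedAddCommGroup E] [InnerProductSpace ℝ E]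
    [FiniteDimensional ℝ E] [MeasurableSpace E] [BorelSpace E] [Nontrivial E] :
    ∃ r m : ℝ, 0 < r ∧ 0 < m ∧ ∀ (μ : Measure E) (f : E → ℝ≥0∞), HasIsotropicDensity μ f →
      ∀ a, ‖a‖ ≤ r → ENNReal.ofReal m ≤ f a := by
  obtain ⟨r, q, hr, hq, H⟩ := exists_halfspace_lower
  obtain ⟨K, hK, HK⟩ := exists_norm_tail E
  obtain ⟨R, hR, hRq⟩ : ∃ R : ℝ, 0 < R ∧ K / R ^ 2 ≤ q / 2 := by
    refine ⟨Real.sqrt (2 * K / q), by positivity, ?_⟩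
    rw [Real.sq_sqrt (by positivity)]
    apply le_of_eq
    field_simp
  set V := (volume (Metric.closedBall (0 : E) R)).toReal with hV
  have hVtop : volume (Metric.closedBall (0 : E) R) ≠ ∞ := measure_closedBall_lt_top.ne
  have hV0 : 0 ≤ V := ENNReal.toReal_nonneg
  refine ⟨r, q / (4 * (V + 1)), hr, by positivity, fun μ f h a ha => ?_⟩
  by_contra! hlt
  have := h.isProbabilityMeasure
  set m := q / (4 * (V + 1)) with hm
  have haS : a ∉ {x | f a < f x} := fun h => lt_irrefl (f a) h
  have hconv := h.logConcave.convex_lt (f a)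
  -- The hyperplane through `a` separates it from the superlevel set. As `‖a‖ ≤ r`, the halfspace `r
  -- < ⟪-u, x⟫` misses the interior of that set, so there `f ≤ f a < m` up to a null frontier. Its
  -- mass is then at most `q / 4` in the ball plus `q / 2` in the tail, less than `q`.
  obtain ⟨u, hu, hsep⟩ := exists_unit_inner_lt_of_convex hconv haS
  set S := {x | f a < f x} with hS
  have hsub : {x | r < ⟪-u, x⟫} ⊆
      frontier S ∪ ({x | f x ≤ f a} ∩ Metric.closedBall 0 R ∪ {x | R ≤ ‖x‖}) := by
    intro x hx
    by_cases hfr : x ∈ frontier S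
    · exact Or.inl hfr
    refine Or.inr ?_
    rcases le_or_gt R ‖x‖ with hxR | hxR
    · exact Or.inr hxR
    refine Or.inl ⟨?_, by simpa using hxR.le⟩
    by_contra! hxS
    have hxS' : x ∈ S := by
      change f a < f x
      exact lt_of_not_ge hxS
    have hxi : x ∈ interior S := by
      by_contra hni
      exact hfr ⟨subset_closure hxS', hni⟩
    have h1 := hsep x hxi
    have h2 := abs_real_inner_le_norm u a
    rw [hu, one_mul] at h2
    have h3 := neg_abs_le ⟪u, a⟫
    have h4 : r < ⟪-u, x⟫ := hx
    rw [inner_neg_left] at h4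
    linarith
  have hfr0 : μ.real (frontier S) = 0 := by
    rw [Measure.real, h.eq_withDensity,
      withDensity_absolutelyContinuous _ _ (hconv.addHaar_frontier volume), ENNReal.toReal_zero]
  have hlow : μ.real ({x | f x ≤ f a} ∩ Metric.closedBall 0 R) ≤ m * V := by
    refine ENNReal.toReal_le_of_le_ofReal (by positivity) ?_
    have hms : MeasurableSet ({x | f x ≤ f a} ∩ Metric.closedBall 0 R) :=
      (measurableSet_le h.measurable measurable_const).inter Metric.isClosed_closedBall.measurableSet
    rw [h.eq_withDensity, withDensity_apply _ hms]
    calc _ ≤ ∫⁻ _ in {x | f x ≤ f a} ∩ Metric.closedBall 0 R, ENNReal.ofReal m :=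
          setLIntegral_mono' hms fun x hx => hx.1.trans hlt.le
      _ ≤ ENNReal.ofReal m * volume (Metric.closedBall (0 : E) R) := by
          rw [setLIntegral_const]
          gcongr
          exact Set.inter_subset_right
      _ = _ := by
          rw [ENNReal.ofReal_mul (by positivity), hV, ENNReal.ofReal_toReal hVtop]
  have htot := (H μ f h (-u) (by rw [norm_neg, hu])).trans
    ((measureReal_mono hsub).trans ((measureReal_union_le _ _).trans
      (add_le_add le_rfl (measureReal_union_le _ _))))
  have htail := HK μ f h R hR
  have hmV : m * V ≤ q / 4 := by
    rw [hm, div_mul_eq_mul_div, div_le_div_iff₀ (by positivity) (by norm_num)]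
    nlinarith
  linarith

end IsotropicBounds

/-! ### Valid constants exist -/

section ValidConstants

open Module

/-- The factor is `2 ^ 2`, from halving lengths in real dimension two. -/
theorem lintegral_comp_midpoint {g : ℂ → ℝ≥0∞} (hg : Measurable g) (x : ℂ) :
    ∫⁻ y, g ((1 / 2 : ℝ) • x + (1 / 2 : ℝ) • y) = 4 * ∫⁻ z, g z := by
  have hm : Measurable fun y : ℂ => (1 / 2 : ℝ) • y := measurable_const_smul _
  have hg' : Measurable fun y : ℂ => g ((1 / 2 : ℝ) • x + y) := hg.comp (measurable_const_add _)
  rw [← lintegral_map (f := fun y : ℂ => g ((1 / 2 : ℝ) • x + y)) hg' hm,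
    Measure.map_addHaar_smul volume (by norm_num : (1 / 2 : ℝ) ≠ 0), lintegral_smul_measure,
    lintegral_add_left_eq_self g, Complex.finrank_real_complex]
  norm_num

/-- An isotropic log-concave density in the plane decays like `‖x‖⁻⁴`. -/
theorem exists_density_decay :
    ∃ K : ℝ, 0 < K ∧ ∀ (μ : Measure ℂ) (f : ℂ → ℝ≥0∞), HasIsotropicDensity μ f → ∀ x,
      f x ≤ ENNReal.ofReal (K / (1 + ‖x‖ ^ 2) ^ 2) := by
  obtain ⟨M, hM, HM⟩ := exists_density_bound_complex
  obtain ⟨K, hK, HK⟩ := exists_norm_tail ℂ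
  set R := 1 + 2 * K with hR
  have hR1 : 1 ≤ R := by linarith
  -- The ball of radius `R` carries at least half of the mass.
  have hRK : K / R ^ 2 ≤ 1 / 2 := by
    rw [div_le_div_iff₀ (by positivity) (by norm_num)]
    nlinarith
  refine ⟨M * (1 + (2 * R) ^ 2) ^ 2 + 4 * (M * (128 * K) ^ 2), by positivity,
    fun μ f h x => ?_⟩
  have := h.isProbabilityMeasure
  rcases le_or_gt ‖x‖ (2 * R) with hx | hx
  · refine (HM μ f h x).trans (ENNReal.ofReal_le_ofReal ?_)
    rw [le_div_iff₀ (by positivity)]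
    calc M * (1 + ‖x‖ ^ 2) ^ 2 ≤ M * (1 + (2 * R) ^ 2) ^ 2 := by gcongr
      _ ≤ _ := by
        have : 0 ≤ 4 * (M * (128 * K) ^ 2) := by positivity
        linarith
  have hx1 : 1 ≤ ‖x‖ := by linarith
  set B := {y : ℂ | ‖y‖ < R} with hB
  have hBm : MeasurableSet B := measurableSet_lt measurable_norm measurable_const
  set T := {z : ℂ | ‖x‖ / 4 ≤ ‖z‖} with hT
  have hTm : MeasurableSet T := measurableSet_le measurable_const measurable_norm
  have hBmass : ENNReal.ofReal (1 / 2) ≤ ∫⁻ y in B, f y := by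
    have e : ∫⁻ y in B, f y = μ B := by rw [h.eq_withDensity, withDensity_apply _ hBm]
    have h1 := probReal_compl_eq_one_sub (μ := μ) hBm
    have h2 : Bᶜ = {y : ℂ | R ≤ ‖y‖} := by ext y; simp [hB]
    have h3 := HK μ f h R (by linarith)
    rw [h2] at h1
    rw [e, ← ofReal_measureReal (by finiteness)]
    exact ENNReal.ofReal_le_ofReal (by linarith)
  have hTmass : ∫⁻ z in T, f z ≤ ENNReal.ofReal (16 * K / ‖x‖ ^ 2) := by
    have e : ∫⁻ z in T, f z = μ T := by rw [h.eq_withDensity, withDensity_apply _ hTm]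
    rw [e, ← ofReal_measureReal (by finiteness)]
    refine ENNReal.ofReal_le_ofReal ((HK μ f h (‖x‖ / 4) (by positivity)).trans_eq ?_)
    field_simp
    norm_num
  have hsq : ∀ a : ℝ≥0∞, a ^ (1 / 2 : ℝ) * a ^ (1 / 2 : ℝ) = a := fun a => by
    rw [← ENNReal.rpow_add_of_nonneg _ _ (by norm_num) (by norm_num)]; norm_num
  set b := ENNReal.ofReal M ^ (1 / 2 : ℝ) with hb
  -- Log-concavity at the midpoint, with one factor `√(f y)` bounded by `√M`. For `y ∈ B` the
  -- midpoint lies in `T`, whose mass is `O(‖x‖⁻²)`; integrating over `B` gives `√(f x) = O(‖x‖⁻²)`.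
  have hpt : ∀ y ∈ B, f x ^ (1 / 2 : ℝ) * f y ≤
      b * T.indicator f ((1 / 2 : ℝ) • x + (1 / 2 : ℝ) • y) := by
    intro y hy
    have hmem : (1 / 2 : ℝ) • x + (1 / 2 : ℝ) • y ∈ T := by
      have h1 : ‖(1 / 2 : ℝ) • x‖ - ‖(1 / 2 : ℝ) • y‖ ≤ ‖(1 / 2 : ℝ) • x + (1 / 2 : ℝ) • y‖ := by
        simpa using norm_sub_norm_le ((1 / 2 : ℝ) • x) (-((1 / 2 : ℝ) • y))
      rw [norm_smul, norm_smul, Real.norm_of_nonneg (by norm_num)] at h1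
      have h2 : ‖y‖ < R := hy
      change ‖x‖ / 4 ≤ _
      linarith
    rw [Set.indicator_of_mem hmem]
    have hlc := h.logConcave x y (1 / 2) ⟨by norm_num, by norm_num⟩
    have e : (1 - 1 / 2 : ℝ) = 1 / 2 := by norm_num
    rw [e] at hlc
    calc f x ^ (1 / 2 : ℝ) * f y
        = f x ^ (1 / 2 : ℝ) * (f y ^ (1 / 2 : ℝ) * f y ^ (1 / 2 : ℝ)) := by rw [hsq]
      _ ≤ f x ^ (1 / 2 : ℝ) * (f y ^ (1 / 2 : ℝ) * b) := by
          gcongr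
          exact ENNReal.rpow_le_rpow (HM μ f h y) (by norm_num)
      _ = b * (f x ^ (1 / 2 : ℝ) * f y ^ (1 / 2 : ℝ)) := by ring
      _ ≤ _ := by gcongr
  have hmain : f x ^ (1 / 2 : ℝ) * ENNReal.ofReal (1 / 2) ≤
      b * (4 * ENNReal.ofReal (16 * K / ‖x‖ ^ 2)) := by
    have him : Measurable (T.indicator f) := h.measurable.indicator hTm
    have him' : Measurable fun y : ℂ => T.indicator f ((1 / 2 : ℝ) • x + (1 / 2 : ℝ) • y) :=
      him.comp ((measurable_const_smul _).const_add _)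
    calc _ ≤ f x ^ (1 / 2 : ℝ) * ∫⁻ y in B, f y := by gcongr
      _ = ∫⁻ y in B, f x ^ (1 / 2 : ℝ) * f y := (lintegral_const_mul _ h.measurable).symm
      _ ≤ ∫⁻ y in B, b * T.indicator f ((1 / 2 : ℝ) • x + (1 / 2 : ℝ) • y) :=
          setLIntegral_mono' hBm hpt
      _ ≤ ∫⁻ y, b * T.indicator f ((1 / 2 : ℝ) • x + (1 / 2 : ℝ) • y) :=
          setLIntegral_le_lintegral _ _
      _ = b * (4 * ∫⁻ z in T, f z) := by
          rw [lintegral_const_mul _ him', lintegral_comp_midpoint him, lintegral_indicator hTm]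
      _ ≤ _ := by gcongr
  have hroot : f x ^ (1 / 2 : ℝ) ≤ b * ENNReal.ofReal (128 * K / ‖x‖ ^ 2) := by
    have h2 : ENNReal.ofReal (1 / 2) * ENNReal.ofReal 2 = 1 := by
      rw [← ENNReal.ofReal_mul (by norm_num)]; norm_num
    have h4 : (4 : ℝ≥0∞) = ENNReal.ofReal 4 := by norm_num
    calc f x ^ (1 / 2 : ℝ) = f x ^ (1 / 2 : ℝ) * ENNReal.ofReal (1 / 2) * ENNReal.ofReal 2 := by
          rw [mul_assoc, h2, mul_one]
      _ ≤ b * (4 * ENNReal.ofReal (16 * K / ‖x‖ ^ 2)) * ENNReal.ofReal 2 := by gcongr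
      _ = b * ENNReal.ofReal (128 * K / ‖x‖ ^ 2) := by
          rw [h4, ← ENNReal.ofReal_mul (by norm_num), mul_assoc,
            ← ENNReal.ofReal_mul (by positivity)]
          ring_nf
  calc f x = f x ^ (1 / 2 : ℝ) * f x ^ (1 / 2 : ℝ) := (hsq _).symm
    _ ≤ (b * ENNReal.ofReal (128 * K / ‖x‖ ^ 2)) * (b * ENNReal.ofReal (128 * K / ‖x‖ ^ 2)) := by
        gcongr
    _ = b * b * (ENNReal.ofReal (128 * K / ‖x‖ ^ 2) * ENNReal.ofReal (128 * K / ‖x‖ ^ 2)) := by ring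
    _ = ENNReal.ofReal (M * ((128 * K / ‖x‖ ^ 2) * (128 * K / ‖x‖ ^ 2))) := by
        rw [hb, hsq, ← ENNReal.ofReal_mul (by positivity), ← ENNReal.ofReal_mul hM.le]
    _ ≤ _ := ENNReal.ofReal_le_ofReal ?_
  have e : M * ((128 * K / ‖x‖ ^ 2) * (128 * K / ‖x‖ ^ 2)) = M * (128 * K) ^ 2 / (‖x‖ ^ 2) ^ 2 := by
    field_simp
  rw [e, div_le_div_iff₀ (by positivity) (by positivity)]
  have hx2 : 1 ≤ ‖x‖ ^ 2 := one_le_pow₀ hx1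
  calc M * (128 * K) ^ 2 * (1 + ‖x‖ ^ 2) ^ 2 ≤ M * (128 * K) ^ 2 * (2 * ‖x‖ ^ 2) ^ 2 := by
        gcongr; linarith
    _ = 4 * (M * (128 * K) ^ 2) * (‖x‖ ^ 2) ^ 2 := by ring
    _ ≤ _ := by
        gcongr
        have : 0 ≤ M * (1 + (2 * R) ^ 2) ^ 2 := by positivity
        linarith

/-- The mass of a thin double wedge around the imaginary axis, away from the origin. -/
theorem exists_wedge_upper :
    ∃ K : ℝ, 0 < K ∧ ∀ (μ : Measure ℂ) (f : ℂ → ℝ≥0∞), HasIsotropicDensity μ f →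
      ∀ s R, 0 ≤ s → 0 ≤ R →
        μ.real {z | |z.re| ≤ s * |z.im| ∧ R ≤ |z.im|} ≤ K * s / (1 + R) := by
  obtain ⟨K, hK, H⟩ := exists_density_decay
  refine ⟨4 * K * Real.pi, by positivity, fun μ f h s R hs hR => ?_⟩
  refine ENNReal.toReal_le_of_le_ofReal (by positivity) ?_
  set W := {z : ℂ | |z.re| ≤ s * |z.im| ∧ R ≤ |z.im|} with hW
  have hWm : MeasurableSet W := by
    have hre : Measurable fun z : ℂ => |z.re| := (continuous_abs.comp Complex.continuous_re).measurable
    have him : Measurable fun z : ℂ => |z.im| := (continuous_abs.comp Complex.continuous_im).measurable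
    exact (measurableSet_le hre (him.const_mul s)).inter (measurableSet_le measurable_const him)
  set φ : ℝ → ℝ≥0∞ := fun y => ENNReal.ofReal (K / (1 + y ^ 2) ^ 2) with hφ
  have hφm : Measurable φ := by fun_prop
  have hmeas : Measurable (W.indicator fun z => φ z.im) :=
    (hφm.comp Complex.measurable_im).indicator hWm
  have e1 : μ W ≤ ∫⁻ z, W.indicator (fun z => φ z.im) z := by
    rw [h.eq_withDensity, withDensity_apply _ hWm, ← lintegral_indicator hWm]
    refine lintegral_mono fun z => Set.indicator_le_indicator' fun _ => ?_
    refine (H μ f h z).trans (ENNReal.ofReal_le_ofReal ?_)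
    have : z.im ^ 2 ≤ ‖z‖ ^ 2 := by
      rw [← sq_abs]
      gcongr
      exact Complex.abs_im_le_norm z
    gcongr
  refine e1.trans ?_
  rw [← Complex.volume_preserving_equiv_real_prod.symm.lintegral_comp hmeas,
    Measure.volume_eq_prod, lintegral_prod_symm'
      (fun p : ℝ × ℝ => W.indicator (fun z => φ z.im) (Complex.measurableEquivRealProd.symm p))
      (hmeas.comp Complex.measurableEquivRealProd.symm.measurable)]
  have hin : ∀ y : ℝ, ∫⁻ x : ℝ, W.indicator (fun z => φ z.im)
      (Complex.measurableEquivRealProd.symm (x, y)) ≤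
        ENNReal.ofReal (4 * K * s / (1 + R) * (1 + y ^ 2)⁻¹) := by
    intro y
    rcases lt_or_ge |y| R with hy | hy
    · refine (lintegral_congr fun x => Set.indicator_of_notMem ?_ _).trans_le
        (lintegral_zero.trans_le zero_le)
      simp [hW, hy]
    · calc _ ≤ ∫⁻ x : ℝ, (Set.Icc (-(s * |y|)) (s * |y|)).indicator (fun _ => φ y) x := by
            refine lintegral_mono fun x => ?_
            by_cases hx : |x| ≤ s * |y|
            · rw [Set.indicator_of_mem (s := Set.Icc _ _) (abs_le.1 hx)]
              refine (Set.indicator_le_self _ _ _).trans_eq ?_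
              simp
            · rw [Set.indicator_of_notMem]
              · exact zero_le
              · simp [hW, hx]
        _ = φ y * ENNReal.ofReal (2 * (s * |y|)) := by
            rw [lintegral_indicator measurableSet_Icc, setLIntegral_const, Real.volume_Icc]
            ring_nf
        _ = ENNReal.ofReal (K / (1 + y ^ 2) ^ 2 * (2 * (s * |y|))) :=
            (ENNReal.ofReal_mul (by positivity)).symm
        _ ≤ _ := ENNReal.ofReal_le_ofReal ?_
      -- Uses `R ≤ |y|`. One factor `1 + y ^ 2` of the decay pays for the slice length and yields `1
      -- / (1 + R)`; the other remains and integrates to `π`.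
      have key : |y| * (1 + R) ≤ 2 * (1 + y ^ 2) := by
        have := sq_abs y
        nlinarith [abs_nonneg y, sq_nonneg (|y| - 1)]
      have e2 : K / (1 + y ^ 2) ^ 2 * (2 * (s * |y|)) =
          2 * K * s / ((1 + R) * (1 + y ^ 2) ^ 2) * (|y| * (1 + R)) := by field_simp
      rw [e2]
      calc _ ≤ 2 * K * s / ((1 + R) * (1 + y ^ 2) ^ 2) * (2 * (1 + y ^ 2)) := by gcongr
        _ = _ := by field_simp; ring
  refine (lintegral_mono hin).trans_eq ?_
  rw [← ofReal_integral_eq_lintegral_ofReal (integrable_inv_one_add_sq.const_mul _)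
    (Filter.Eventually.of_forall fun y => by positivity), integral_const_mul,
    integral_univ_inv_one_add_sq]
  ring_nf

/-- The mass of a box next to the origin. -/
theorem exists_box_lower :
    ∃ r m : ℝ, 0 < r ∧ 0 < m ∧ ∀ (μ : Measure ℂ) (f : ℂ → ℝ≥0∞), HasIsotropicDensity μ f →
      ∀ a, 0 ≤ a → a ≤ r →
        m * a ≤ μ.real {z | (0 < z.re ∧ z.re < a) ∧ (-(2 * r) < z.im ∧ z.im < -r)} := by
  obtain ⟨r, m, hr, hm, H⟩ := exists_density_lower ℂ
  -- Quartering `r` keeps the box inside the ball of radius `r`: its points have norm at most `r / 4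
  -- + r / 2`.
  refine ⟨r / 4, m * (r / 4), by positivity, by positivity, fun μ f h a ha har => ?_⟩
  have := h.isProbabilityMeasure
  set S := {z : ℂ | (0 < z.re ∧ z.re < a) ∧ (-(2 * (r / 4)) < z.im ∧ z.im < -(r / 4))} with hS
  have hpre : S = Complex.measurableEquivRealProd ⁻¹'
      (Set.Ioo 0 a ×ˢ Set.Ioo (-(2 * (r / 4))) (-(r / 4))) := by
    ext z; simp [hS]
  have hBm : MeasurableSet (Set.Ioo 0 a ×ˢ Set.Ioo (-(2 * (r / 4))) (-(r / 4))) :=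
    measurableSet_Ioo.prod measurableSet_Ioo
  have hSm : MeasurableSet S := hpre ▸ Complex.measurableEquivRealProd.measurable hBm
  have hvol : volume S = ENNReal.ofReal a * ENNReal.ofReal (r / 4) := by
    rw [hpre, Complex.volume_preserving_equiv_real_prod.measure_preimage hBm.nullMeasurableSet,
      Measure.volume_eq_prod, Measure.prod_prod, Real.volume_Ioo, Real.volume_Ioo]
    ring_nf
  have key : ENNReal.ofReal (m * (r / 4) * a) ≤ μ S := by
    rw [h.eq_withDensity, withDensity_apply _ hSm]
    calc ENNReal.ofReal (m * (r / 4) * a) = ∫⁻ _ in S, ENNReal.ofReal m := by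
          rw [setLIntegral_const, hvol, ← ENNReal.ofReal_mul ha, ← ENNReal.ofReal_mul hm.le]
          ring_nf
      _ ≤ _ := setLIntegral_mono' hSm fun z hz => H μ f h z ?_
    have := Complex.norm_le_abs_re_add_abs_im z
    have h1 : |z.re| ≤ r / 4 := by rw [abs_of_pos hz.1.1]; linarith [hz.1.2]
    have h2 : |z.im| ≤ 2 * (r / 4) := by
      rw [abs_of_neg (by linarith [hz.2.2])]; linarith [hz.2.1]
    linarith
  exact (ENNReal.ofReal_le_iff_le_toReal (by finiteness)).1 key

/-- The mass of a band is bounded below. -/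
theorem exists_band_lower :
    ∃ c : ℝ, 0 < c ∧ ∀ {E : Type} [NormedAddCommGroup E] [InnerProductSpace ℝ E]
      [FiniteDimensional ℝ E] [MeasurableSpace E] [BorelSpace E] (μ : Measure E) (f : E → ℝ≥0∞),
      HasIsotropicDensity μ f → ∀ u : E, ‖u‖ = 1 → ∀ γ, 0 ≤ γ → γ ≤ 1 →
        c * γ ≤ μ.real {x | |⟪u, x⟫| ≤ γ} := by
  obtain ⟨r, m, hr, hm, H⟩ := exists_density_lower ℝ
  -- Since `γ ≤ 1`, the half-width `min r 1 * γ` is at most both `r`, where the density bound holds,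
  -- and `γ`.
  refine ⟨2 * m * min r 1, by positivity, ?_⟩
  intro E _ _ _ _ _ μ f h u hu γ hγ hγ1
  have := h.isProbabilityMeasure
  obtain ⟨g, hg⟩ := h.exists_marginal_real hu
  have hmeas : Measurable fun x : E => ⟪u, x⟫ := by fun_prop
  set c := min r 1 * γ with hc
  have hr1 : 0 < min r 1 := by positivity
  have hc0 : 0 ≤ c := by positivity
  have hcr : c ≤ r := (mul_le_of_le_one_right hr1.le hγ1).trans (min_le_left _ _)
  have hcγ : c ≤ γ := mul_le_of_le_one_left hγ (min_le_right _ _)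
  have key : ENNReal.ofReal (2 * m * min r 1 * γ) ≤ μ {x | |⟪u, x⟫| ≤ γ} := by
    calc ENNReal.ofReal (2 * m * min r 1 * γ) = ∫⁻ _ in Set.Icc (-c) c, ENNReal.ofReal m := by
          rw [setLIntegral_const, Real.volume_Icc, ← ENNReal.ofReal_mul hm.le, hc]
          ring_nf
      _ ≤ ∫⁻ t in Set.Icc (-c) c, g t :=
          setLIntegral_mono' measurableSet_Icc fun t ht => H _ _ hg t ((abs_le.2 ht).trans hcr)
      _ = (μ.map fun x => ⟪u, x⟫) (Set.Icc (-c) c) := by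
          rw [hg.eq_withDensity, withDensity_apply _ measurableSet_Icc]
      _ = μ ((fun x => ⟪u, x⟫) ⁻¹' Set.Icc (-c) c) := Measure.map_apply hmeas measurableSet_Icc
      _ ≤ _ := measure_mono fun x hx => (abs_le.2 hx).trans hcγ
  exact (ENNReal.ofReal_le_iff_le_toReal (by finiteness)).1 key

end ValidConstants

/-! ### Angles, reduction to a plane, and the choice of constants -/

section Valid

variable {d : ℕ}

theorem norm_unitVec (w : UnitVec d) : ‖(w : Space d)‖ = 1 := norm_eq_of_mem_sphere w

theorem theta_nonneg (w w' : UnitVec d) : 0 ≤ theta w w' := angle_nonneg _ _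

theorem theta_comm (w w' : UnitVec d) : theta w w' = theta w' w := angle_comm _ _

theorem cos_theta (w w' : UnitVec d) : Real.cos (theta w w') = ⟪(w : Space d), (w' : Space d)⟫ := by
  rw [theta, cos_angle, norm_unitVec, norm_unitVec]; simp

theorem eq_of_theta_eq_zero {w w' : UnitVec d} (h : theta w w' = 0) : w = w' := by
  have h1 := cos_theta w w'
  rw [h, Real.cos_zero] at h1
  exact Subtype.ext ((inner_eq_one_iff_of_norm_eq_one (norm_unitVec w) (norm_unitVec w')).1 h1.symm)

theorem neg_eq_of_theta_eq_pi {w w' : UnitVec d} (h : theta w w' = Real.pi) :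
    (w' : Space d) = -(w : Space d) := by
  have h1 := cos_theta w w'
  rw [h, Real.cos_pi] at h1
  have h2 : ⟪(w : Space d), -(w' : Space d)⟫ = 1 := by rw [inner_neg_right]; linarith
  have := (inner_eq_one_iff_of_norm_eq_one (𝕜 := ℝ) (norm_unitVec w)
    (by rw [norm_neg, norm_unitVec])).1 h2
  rw [this, neg_neg]

theorem halfspace_ne_iff (w w' : UnitVec d) (x : Space d) :
    halfspace w x ≠ halfspace w' x ↔ ¬ (0 ≤ ⟪(w : Space d), x⟫ ↔ 0 ≤ ⟪(w' : Space d), x⟫) := by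
  unfold halfspace
  split_ifs with h h' h' <;> simp [h, h']

/-- The plane spanned by two unit vectors at an angle in `(0, π)`. -/
theorem exists_planar_marginal {P : Measure (Space d)} {p : Space d → ℝ≥0∞}
    (hP : HasIsotropicDensity P p) {w w' : UnitVec d} (h0 : 0 < theta w w')
    (hπ : theta w w' < Real.pi) :
    ∃ (T : Space d → ℂ) (f : ℂ → ℝ≥0∞), Measurable T ∧ HasIsotropicDensity (P.map T) f ∧
      (∀ x, ⟪(w : Space d), x⟫ = (T x).re) ∧
      ∀ x, ⟪(w' : Space d), x⟫ =
        Real.cos (theta w w') * (T x).re + Real.sin (theta w w') * (T x).im := by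
  set θ := theta w w' with hθ
  have hsin : 0 < Real.sin θ := Real.sin_pos_of_pos_of_lt_pi h0 hπ
  -- Gram–Schmidt: `w`, `v` is an orthonormal basis of the plane, and `T` below reads off the
  -- coordinates in it.
  set v : Space d := (Real.sin θ)⁻¹ • ((w' : Space d) - Real.cos θ • (w : Space d)) with hv
  have hww : ⟪(w : Space d), (w : Space d)⟫ = 1 := by
    rw [real_inner_self_eq_norm_sq, norm_unitVec, one_pow]
  have hww' : ⟪(w' : Space d), (w' : Space d)⟫ = 1 := by
    rw [real_inner_self_eq_norm_sq, norm_unitVec, one_pow]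
  have hc : ⟪(w : Space d), (w' : Space d)⟫ = Real.cos θ := (cos_theta w w').symm
  have hc' : ⟪(w' : Space d), (w : Space d)⟫ = Real.cos θ := by rw [real_inner_comm, hc]
  have hsc := Real.sin_sq_add_cos_sq θ
  have hwv : ⟪(w : Space d), v⟫ = 0 := by
    rw [hv, real_inner_smul_right, inner_sub_right, real_inner_smul_right, hww, hc]; ring
  have hvv : ⟪v, v⟫ = 1 := by
    rw [hv, real_inner_smul_right, real_inner_smul_left, inner_sub_right, inner_sub_left,
      inner_sub_left, real_inner_smul_right, real_inner_smul_right, real_inner_smul_left,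
      real_inner_smul_left, hww, hww', hc, hc']
    field_simp
    linear_combination -hsc
  have hvn : ‖v‖ ^ 2 = 1 := by rw [← real_inner_self_eq_norm_sq, hvv]
  let J : ℂ →ₗᵢ[ℝ] Space d :=
    { toFun := fun z => z.re • (w : Space d) + z.im • v
      map_add' := fun a b => by simp only [Complex.add_re, Complex.add_im]; module
      map_smul' := fun a b => by
        simp only [Complex.smul_re, Complex.smul_im, smul_eq_mul, RingHom.id_apply]; module
      norm_map' := fun z => by
        have : ‖z.re • (w : Space d) + z.im • v‖ ^ 2 = ‖z‖ ^ 2 := by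
          rw [norm_add_sq_real, real_inner_smul_left, real_inner_smul_right, hwv, norm_smul,
            norm_smul, mul_pow, mul_pow, hvn, norm_unitVec, ← Complex.normSq_eq_norm_sq,
            Complex.normSq_apply, Real.norm_eq_abs, Real.norm_eq_abs, sq_abs, sq_abs]
          ring
        exact (sq_eq_sq₀ (norm_nonneg _) (norm_nonneg _)).1 this }
  let T : Space d →L[ℝ] ℂ :=
    Complex.ofRealCLM.comp (innerSL ℝ (w : Space d)) +
      Complex.I • Complex.ofRealCLM.comp (innerSL ℝ v)
  have hre : ∀ x, (T x).re = ⟪(w : Space d), x⟫ := fun x => by simp [T]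
  have him : ∀ x, (T x).im = ⟪v, x⟫ := fun x => by simp [T]
  obtain ⟨f, hf⟩ := hP.exists_marginal J T fun z x => by
    change ⟪z, T x⟫ = ⟪z.re • (w : Space d) + z.im • v, x⟫
    rw [inner_add_left, real_inner_smul_left, real_inner_smul_left, ← hre, ← him]
    simp [Complex.inner]
    ring
  refine ⟨T, f, T.continuous.measurable, hf, fun x => (hre x).symm, fun x => ?_⟩
  have hw' : (w' : Space d) = Real.cos θ • (w : Space d) + Real.sin θ • v := by
    rw [hv, smul_smul, mul_inv_cancel₀ hsin.ne', one_smul]; abel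
  rw [hw', inner_add_left, real_inner_smul_left, real_inner_smul_left, hre, him]

/-- `X` and `Y` are the planar coordinates along `w` and orthogonally to it. For the signs to
differ, `sin θ * Y` has to outweigh `cos θ * X`, which describes a double wedge when `cos θ > 0`. -/
theorem abs_mul_cos_le_of_disagree {θ X Y : ℝ} (hs : 0 ≤ Real.sin θ)
    (h : ¬ (0 ≤ X ↔ 0 ≤ Real.cos θ * X + Real.sin θ * Y)) :
    |X| * Real.cos θ ≤ Real.sin θ * |Y| := by
  have h1 := mul_le_mul_of_nonneg_left (le_abs_self Y) hs
  have h2 := mul_le_mul_of_nonneg_left (neg_abs_le Y) hs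
  rcases le_or_gt 0 X with hX | hX
  · rw [abs_of_nonneg hX]
    have : Real.cos θ * X + Real.sin θ * Y < 0 := by
      by_contra! h3
      exact h ⟨fun _ => h3, fun _ => hX⟩
    linarith
  · rw [abs_of_neg hX]
    have : 0 ≤ Real.cos θ * X + Real.sin θ * Y := by
      by_contra! h3
      exact h ⟨fun h4 => absurd h4 hX.not_ge, fun h4 => absurd h4 h3.not_ge⟩
    linarith

theorem abs_le_of_disagree {θ X Y : ℝ} (h0 : 0 ≤ θ) (h1 : θ ≤ 1)
    (h : ¬ (0 ≤ X ↔ 0 ≤ Real.cos θ * X + Real.sin θ * Y)) : |X| ≤ 2 * θ * |Y| := by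
  have hs : 0 ≤ Real.sin θ :=
    Real.sin_nonneg_of_nonneg_of_le_pi h0 (by linarith [Real.pi_gt_three])
  have key := abs_mul_cos_le_of_disagree hs h
  have hc : 1 / 2 ≤ Real.cos θ := by
    have := Real.one_sub_sq_div_two_le_cos (x := θ)
    nlinarith
  have h2 := mul_le_mul_of_nonneg_right (Real.sin_le h0) (abs_nonneg Y)
  have h3 := mul_le_mul_of_nonneg_left hc (abs_nonneg X)
  linarith

/-- Disagreement of two halfspaces far from the boundary of the first one, for a small angle. -/
theorem exists_disagreement_tail :
    ∃ K : ℝ, 0 < K ∧ ∀ (d : ℕ) (P : Measure (Space d)), IsIsotropicLogConcave P →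
      ∀ (w w' : UnitVec d) (R : ℝ), 0 ≤ R → theta w w' ≤ 1 →
        P.real {x | 2 * theta w w' * R ≤ |⟪(w : Space d), x⟫| ∧ halfspace w x ≠ halfspace w' x}
          ≤ K * theta w w' / (1 + R) := by
  obtain ⟨K, hK, H⟩ := exists_wedge_upper
  refine ⟨2 * K, by positivity, fun d P hP w w' R hR h1 => ?_⟩
  have := hP.isProbabilityMeasure
  rcases (theta_nonneg w w').eq_or_lt with h0 | h0
  · obtain rfl := eq_of_theta_eq_zero h0.symm
    simp [← h0]
  obtain ⟨p, hp⟩ := hP.hasIsotropicDensity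
  obtain ⟨T, f, hT, hf, hre, him⟩ := exists_planar_marginal hp h0
    (by linarith [Real.pi_gt_three])
  have := hf.isProbabilityMeasure
  set θ := theta w w'
  have hre' : Measurable fun z : ℂ => |z.re| := (continuous_abs.comp Complex.continuous_re).measurable
  have him' : Measurable fun z : ℂ => |z.im| := (continuous_abs.comp Complex.continuous_im).measurable
  calc _ ≤ P.real (T ⁻¹' {z | |z.re| ≤ 2 * θ * |z.im| ∧ R ≤ |z.im|}) := by
        refine measureReal_mono fun x hx => ?_
        obtain ⟨hx1, hx2⟩ := hx
        rw [halfspace_ne_iff, hre, him] at hx2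
        rw [hre] at hx1
        have h2 := abs_le_of_disagree h0.le h1 hx2
        refine ⟨h2, ?_⟩
        exact le_of_mul_le_mul_left (hx1.trans h2) (by positivity)
    _ = (P.map T).real {z | |z.re| ≤ 2 * θ * |z.im| ∧ R ≤ |z.im|} :=
        (map_measureReal_apply hT ((measurableSet_le hre' (him'.const_mul _)).inter
          (measurableSet_le measurable_const him'))).symm
    _ ≤ K * (2 * θ) / (1 + R) := H _ f hf _ _ (by positivity) hR
    _ = _ := by ring

/-- Setting `R = 0` in the tail bound removes the margin condition; for angles above one the trivial
bound suffices. -/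
theorem exists_angle_upper :
    ∃ C : ℝ, 0 < C ∧ ∀ (d : ℕ) (P : Measure (Space d)), IsIsotropicLogConcave P →
      ∀ w w' : UnitVec d, P.real {x | halfspace w x ≠ halfspace w' x} ≤ C * theta w w' := by
  obtain ⟨K, hK, H⟩ := exists_disagreement_tail
  refine ⟨1 + K, by positivity, fun d P hP w w' => ?_⟩
  have := hP.isProbabilityMeasure
  have h0 := theta_nonneg w w'
  rcases le_or_gt (theta w w') 1 with h1 | h1
  · have := H d P hP w w' 0 le_rfl h1
    simp only [mul_zero, abs_nonneg, true_and, add_zero, div_one] at this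
    linarith
  · refine measureReal_le_one.trans ?_
    nlinarith

theorem exists_angle_lower :
    ∃ c : ℝ, 0 < c ∧ ∀ (d : ℕ) (P : Measure (Space d)), IsIsotropicLogConcave P →
      ∀ w w' : UnitVec d, c * theta w w' ≤ P.real {x | halfspace w x ≠ halfspace w' x} := by
  obtain ⟨r, m, hr, hm, H⟩ := exists_box_lower
  obtain ⟨C, hC, HC⟩ := exists_band_upper
  have hpi := Real.pi_pos
  refine ⟨min (m * r / Real.pi) (1 / Real.pi), by positivity, fun d P hP w w' => ?_⟩
  have := hP.isProbabilityMeasure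
  obtain ⟨p, hp⟩ := hP.hasIsotropicDensity
  have hc1 : min (m * r / Real.pi) (1 / Real.pi) ≤ m * r / Real.pi := min_le_left _ _
  have hc2 : min (m * r / Real.pi) (1 / Real.pi) ≤ 1 / Real.pi := min_le_right _ _
  rcases (theta_nonneg w w').eq_or_lt with h0 | h0
  · rw [← h0, mul_zero]; exact measureReal_nonneg
  rcases (angle_le_pi (w : Space d) (w' : Space d)).eq_or_lt with hπ | hπ
  -- Antipodal vectors span no plane, but they disagree off the hyperplane orthogonal to `w`, which
  -- is null by the band bound at `γ = 0`.
  · change theta w w' = Real.pi at hπ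
    have hneg := neg_eq_of_theta_eq_pi hπ
    have hband := HC P p hp w (norm_unitVec w) 0 le_rfl
    rw [mul_zero] at hband
    have hm0 : MeasurableSet {x : Space d | |⟪(w : Space d), x⟫| ≤ 0} :=
      measurableSet_le (by fun_prop) measurable_const
    have h1 := probReal_compl_eq_one_sub (μ := P) hm0
    have h2 : P.real {x : Space d | |⟪(w : Space d), x⟫| ≤ 0}ᶜ ≤
        P.real {x | halfspace w x ≠ halfspace w' x} := by
      refine measureReal_mono fun x hx => ?_
      simp only [Set.mem_compl_iff, Set.mem_ofPred_eq, abs_nonpos_iff] at hx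
      change halfspace w x ≠ halfspace w' x
      rw [halfspace_ne_iff, hneg, inner_neg_left]
      rcases lt_or_gt_of_ne hx with h | h
      · intro h3
        exact h.not_ge (h3.2 (by linarith))
      · intro h3
        have := h3.1 h.le
        linarith
    have h3 := measureReal_nonneg (μ := P) (s := {x : Space d | |⟪(w : Space d), x⟫| ≤ 0})
    have h4 : 1 / Real.pi * Real.pi = 1 := by field_simp
    rw [hπ]
    nlinarith
  change theta w w' < Real.pi at hπ
  obtain ⟨T, f, hT, hf, hre, him⟩ := exists_planar_marginal hp h0 hπ
  have := hf.isProbabilityMeasure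
  set θ := theta w w'
  have hsin : 0 < Real.sin θ := Real.sin_pos_of_pos_of_lt_pi h0 hπ
  -- On the box `0 < X < a`, `Y < -r` one has `cos θ * X + sin θ * Y < 0`, so the signs differ. The
  -- width is `a = r * sin θ` for `θ ≤ π / 2`, with `sin θ ≥ 2 * θ / π`, and `a = r` for obtuse
  -- angles.
  have main : ∀ a, 0 ≤ a → a ≤ r → (0 ≤ Real.cos θ → a ≤ r * Real.sin θ) →
      m * a ≤ P.real {x | halfspace w x ≠ halfspace w' x} := by
    intro a ha har hac
    refine (H _ f hf a ha har).trans ?_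
    rw [map_measureReal_apply hT]
    · refine measureReal_mono fun x hx => ?_
      obtain ⟨⟨hx1, hx2⟩, hx3, hx4⟩ := hx
      change halfspace w x ≠ halfspace w' x
      rw [halfspace_ne_iff, hre, him]
      intro hiff
      have h1 := hiff.1 hx1.le
      have h2 : Real.sin θ * (T x).im < -(r * Real.sin θ) := by nlinarith
      rcases le_or_gt 0 (Real.cos θ) with hcos | hcos
      · have h3 : Real.cos θ * (T x).re ≤ (T x).re :=
          mul_le_of_le_one_left hx1.le (Real.cos_le_one θ)
        linarith [hac hcos]
      · have h3 : Real.cos θ * (T x).re < 0 := mul_neg_of_neg_of_pos hcos hx1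
        have : 0 < r * Real.sin θ := by positivity
        linarith
    · have hre' := Complex.measurable_re
      have him' := Complex.measurable_im
      exact ((measurableSet_lt measurable_const hre').inter
        (measurableSet_lt hre' measurable_const)).inter
        ((measurableSet_lt measurable_const him').inter (measurableSet_lt him' measurable_const))
  have hbound : min (m * r / Real.pi) (1 / Real.pi) * θ ≤ m * r / Real.pi * θ := by gcongr
  refine hbound.trans ?_
  rcases le_or_gt θ (Real.pi / 2) with hθ | hθ
  · refine le_trans ?_ (main (r * Real.sin θ) (by positivity)
      (mul_le_of_le_one_right hr.le (Real.sin_le_one θ)) fun _ => le_rfl)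
    have := Real.mul_le_sin h0.le hθ
    calc m * r / Real.pi * θ ≤ m * r * (2 / Real.pi * θ) := by
          have : 0 ≤ m * r / Real.pi * θ := by positivity
          calc _ ≤ 2 * (m * r / Real.pi * θ) := by linarith
            _ = _ := by ring
      _ ≤ m * r * Real.sin θ := by gcongr
      _ = _ := by ring
  · refine le_trans ?_ (main r hr.le le_rfl fun hcos => ?_)
    · rw [div_mul_eq_mul_div, div_le_iff₀ hpi]
      gcongr
    · have := Real.cos_neg_of_pi_div_two_lt_of_lt hθ (by linarith)
      linarith

theorem exists_valid_constants : ∃ C : Constants, C.Valid := by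
  obtain ⟨C1u, hC1u, H1u⟩ := exists_angle_upper
  obtain ⟨C1l, hC1l, H1l⟩ := exists_angle_lower
  obtain ⟨C2u, hC2u, H2u⟩ := exists_band_upper
  obtain ⟨C2l, hC2l, H2l⟩ := exists_band_lower
  obtain ⟨K, hK, HK⟩ := exists_disagreement_tail
  set R := 8 * K / C1l with hR
  have hR0 : 0 < R := by positivity
  -- For angles at most one, `2 * R` feeds the tail bound, and `K / R = C1l / 8`. For larger angles
  -- `α > 1`, and `1 + 8 / C1l` feeds Chebyshev's inequality.
  refine ⟨⟨C1u, C1l, C2u, C2l, 1 + 8 / C1l + 2 * R⟩, hC1u, hC1l, hC2u, hC2l, by positivity,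
    H1l, H1u, ?_, ?_, ?_⟩
  · intro d P hP w γ hγ hγ1
    obtain ⟨p, hp⟩ := hP.hasIsotropicDensity
    exact H2l P p hp w (norm_unitVec w) γ hγ hγ1
  · intro d P hP w γ hγ
    obtain ⟨p, hp⟩ := hP.hasIsotropicDensity
    exact H2u P p hp w (norm_unitVec w) γ hγ
  · intro d P hP w w' α hα _
    have := hP.isProbabilityMeasure
    obtain ⟨p, hp⟩ := hP.hasIsotropicDensity
    have h0 := theta_nonneg w w'
    have hα0 : 0 ≤ α := h0.trans hα
    have h8 : 0 < 8 / C1l := by positivity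
    change P.real {x | (1 + 8 / C1l + 2 * R) * α ≤ |⟪(w : Space d), x⟫| ∧ _} ≤ α * (C1l / 8)
    rcases le_or_gt (theta w w') 1 with h1 | h1
    · calc _ ≤ P.real {x | 2 * theta w w' * R ≤ |⟪(w : Space d), x⟫| ∧
            halfspace w x ≠ halfspace w' x} := by
            refine measureReal_mono fun x hx => ⟨le_trans ?_ hx.1, hx.2⟩
            have : theta w w' * R ≤ α * R := by gcongr
            nlinarith
        _ ≤ K * theta w w' / (1 + R) := HK d P hP w w' R hR0.le h1
        _ ≤ K * α / R := by gcongr; linarith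
        _ = α * (C1l / 8) := by rw [hR]; field_simp
    · have hα1 : 1 < α := h1.trans_le hα
      calc _ ≤ P.real {x | (1 + 8 / C1l) ≤ |⟪(w : Space d), x⟫|} := by
            refine measureReal_mono fun x hx => le_trans ?_ hx.1
            nlinarith
        _ ≤ 1 / (1 + 8 / C1l) ^ 2 :=
            hp.measureReal_abs_inner_ge_le (norm_unitVec w) (by positivity)
        _ ≤ 1 / (8 / C1l) := by
            gcongr
            nlinarith
        _ = C1l / 8 := by field_simp
        _ ≤ α * (C1l / 8) := le_mul_of_one_le_left (by positivity) hα1.le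

end Valid

/-! ### Fresh blocks of an i.i.d. stream -/

section FreshBlocks

theorem lintegral_eq_of_indepFun {Ω α β : Type*} [MeasurableSpace Ω] [MeasurableSpace α]
    [MeasurableSpace β] {μ : Measure Ω} [IsProbabilityMeasure μ] {X : Ω → α} {Y : Ω → β}
    (h : IndepFun X Y μ) (hX : Measurable X) (hY : Measurable Y) {F : α × β → ℝ≥0∞}
    (hF : Measurable F) :
    ∫⁻ ω, F (X ω, Y ω) ∂μ = ∫⁻ ω, ∫⁻ y, F (X ω, y) ∂(μ.map Y) ∂μ := by
  have := Measure.isProbabilityMeasure_map (μ := μ) hY.aemeasurable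
  rw [← lintegral_map hF (hX.prodMk hY),
    (indepFun_iff_map_prod_eq_prod_map_map hX.aemeasurable hY.aemeasurable).1 h,
    lintegral_prod _ hF.aemeasurable, lintegral_map hF.lintegral_prod_right' hX]

/-- Freezing lemma for independent pairs on the two factors of a product space. -/
theorem lintegral_prod_eq_of_indepFun {S U A B Z Y : Type*} [MeasurableSpace S] [MeasurableSpace U]
    [MeasurableSpace A] [MeasurableSpace B] [MeasurableSpace Z] [MeasurableSpace Y]
    {μ : Measure S} {ν : Measure U} [IsProbabilityMeasure μ] [IsProbabilityMeasure ν]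
    {a : S → A} {z : S → Z} {b : U → B} {y : U → Y} (ha : Measurable a) (hz : Measurable z)
    (hb : Measurable b) (hy : Measurable y) (haz : IndepFun a z μ) (hby : IndepFun b y ν)
    {G : (A × B) × (Z × Y) → ℝ≥0∞} (hG : Measurable G) :
    ∫⁻ ω, G ((a ω.1, b ω.2), (z ω.1, y ω.2)) ∂(μ.prod ν) =
      ∫⁻ ω, ∫⁻ q, G ((a ω.1, b ω.2), q) ∂((μ.map z).prod (ν.map y)) ∂(μ.prod ν) := by
  have := Measure.isProbabilityMeasure_map (μ := μ) hz.aemeasurable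
  have := Measure.isProbabilityMeasure_map (μ := ν) hy.aemeasurable
  have hG1 : Measurable fun ω : S × U => G ((a ω.1, b ω.2), (z ω.1, y ω.2)) :=
    hG.comp (by fun_prop)
  have hG2 : Measurable fun p : (A × Z) × B × Y => G ((p.1.1, p.2.1), (p.1.2, p.2.2)) :=
    hG.comp (by fun_prop)
  have hG3 : Measurable fun p : ((A × Z) × U) × Y => G ((p.1.1.1, b p.1.2), (p.1.1.2, p.2)) :=
    hG.comp (by fun_prop)
  have hH : Measurable fun p : A × Z => ∫⁻ u, ∫⁻ y', G ((p.1, b u), (p.2, y')) ∂(ν.map y) ∂ν :=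
    hG3.lintegral_prod_right'.lintegral_prod_right'
  have hR : Measurable fun ω : S × U =>
      ∫⁻ q, G ((a ω.1, b ω.2), q) ∂((μ.map z).prod (ν.map y)) := by
    have : Measurable fun p : (S × U) × (Z × Y) => G ((a p.1.1, b p.1.2), p.2) :=
      hG.comp (by fun_prop)
    exact this.lintegral_prod_right'
  rw [lintegral_prod _ hG1.aemeasurable, lintegral_prod _ hR.aemeasurable]
  have e1 : ∀ s, ∫⁻ u, G ((a s, b u), (z s, y u)) ∂ν =
      ∫⁻ u, ∫⁻ y', G ((a s, b u), (z s, y')) ∂(ν.map y) ∂ν := fun s =>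
    lintegral_eq_of_indepFun (F := fun p : B × Y => G ((a s, p.1), (z s, p.2))) hby hb hy
      (hG.comp (by fun_prop))
  simp only [e1]
  rw [lintegral_eq_of_indepFun (F := fun p : A × Z =>
    ∫⁻ u, ∫⁻ y', G ((p.1, b u), (p.2, y')) ∂(ν.map y) ∂ν) haz ha hz hH]
  refine lintegral_congr fun s => ?_
  have hsw : Measurable fun p : Z × U => ∫⁻ y', G ((a s, b p.2), (p.1, y')) ∂(ν.map y) := by
    have : Measurable fun p : (Z × U) × Y => G ((a s, b p.1.2), (p.1.1, p.2)) :=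
      hG.comp (by fun_prop)
    exact this.lintegral_prod_right'
  rw [lintegral_lintegral_swap hsw.aemeasurable]
  refine lintegral_congr fun u => ?_
  have hq : Measurable fun q : Z × Y => G ((a s, b u), q) := hG.comp (by fun_prop)
  exact (lintegral_prod _ hq.aemeasurable).symm

/-- The stream `s` with all entries from `N` on replaced by `x`. -/
def truncate {X : Type*} (x : X) (N : ℕ) (s : ℕ → X) (i : ℕ) : X := if i < N then s i else x

theorem measurable_truncate {X : Type*} [MeasurableSpace X] (x : X) (N : ℕ) :
    Measurable (truncate x N) := by
  refine measurable_pi_lambda _ fun i => ?_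
  unfold truncate
  split_ifs
  · exact measurable_pi_apply i
  · exact measurable_const

variable {X : Type*} [MeasurableSpace X] (D : Measure X) [IsProbabilityMeasure D]

/-- The two maps are functions of the disjoint sets of coordinates `[0, N)` and `[N, N + m)` of an
independent family. -/
theorem indepFun_truncate_block (x : X) (N m : ℕ) :
    IndepFun (truncate x N) (fun (s : ℕ → X) (i : Fin m) => s (N + i))
      (Measure.infinitePi fun _ : ℕ => D) := by
  have h : iIndepFun (fun (i : ℕ) (s : ℕ → X) => s i) (Measure.infinitePi fun _ : ℕ => D) :=
    iIndepFun_infinitePi (X := fun _ ω => ω) (fun _ => measurable_id)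
  have h2 := h.indepFun_finset (Finset.range N) (Finset.Ico N (N + m))
    (Finset.range_eq_Ico N ▸ Finset.Ico_disjoint_Ico_consecutive 0 N (N + m))
    (fun i => measurable_pi_apply i)
  let φ : (Finset.range N → X) → ℕ → X := fun a i =>
    if hi : i ∈ Finset.range N then a ⟨i, hi⟩ else x
  let ψ : (Finset.Ico N (N + m) → X) → Fin m → X := fun a i =>
    a ⟨N + i, Finset.mem_Ico.2 ⟨Nat.le_add_right _ _, Nat.add_lt_add_left i.2 _⟩⟩
  have hφ : Measurable φ := by
    refine measurable_pi_lambda _ fun i => ?_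
    by_cases hi : i ∈ Finset.range N
    · simp only [φ, hi, dite_true]; exact measurable_pi_apply _
    · simp only [φ, hi, dite_false]; exact measurable_const
  have hψ : Measurable ψ := measurable_pi_lambda _ fun i => measurable_pi_apply _
  have e : truncate x N = φ ∘ fun (s : ℕ → X) (i : Finset.range N) => s i := by
    funext s i
    simp [truncate, φ]
  rw [e]
  exact h2.comp hφ hψ

theorem map_block (N m : ℕ) :
    (Measure.infinitePi fun _ : ℕ => D).map (fun (s : ℕ → X) (i : Fin m) => s (N + i)) =
      Measure.pi fun _ : Fin m => D := by
  rw [← Measure.infinitePi_eq_pi]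
  exact Measure.map_infinitePi_infinitePi_of_inj (P := fun _ : ℕ => D)
    (f := fun i : Fin m => N + (i : ℕ)) fun i j hij => Fin.ext (Nat.add_left_cancel hij)

theorem indepFun_truncate_eval (x : X) (k : ℕ) :
    IndepFun (truncate x k) (fun s : ℕ → X => s k) (Measure.infinitePi fun _ : ℕ => D) :=
  (indepFun_truncate_block D x k 1).comp measurable_id (measurable_pi_apply 0)

end FreshBlocks

/-! ### The run of the algorithm -/

section Run

namespace BandOracle

variable {d : ℕ} {Ω : Type*} [MeasurableSpace Ω] (O : BandOracle d Ω) (C : Constants) (ε δ : ℝ)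
  (w₁ : UnitVec d)

/-- The number of samples taken in the first `k` rounds. -/
noncomputable def samplesUpTo (k : ℕ) : ℕ :=
  ∑ j ∈ Finset.Icc 1 k, O.samples (C.gamma j) (δ / C.rounds ε) (alpha j)

theorem state_snd (s : ℕ → Sample d) (u : ℕ → Ω) (k : ℕ) :
    (O.state C ε δ w₁ s u k).2 = O.samplesUpTo C ε δ k := by
  induction k with
  | zero => rfl
  | succ k ih =>
    rw [samplesUpTo, Finset.sum_Icc_succ_top (by omega), ← samplesUpTo, ← ih]
    rfl

theorem state_succ_fst (s : ℕ → Sample d) (u : ℕ → Ω) (k : ℕ) :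
    (O.state C ε δ w₁ s u (k + 1)).1 =
      O.run (O.state C ε δ w₁ s u k).1 (C.gamma (k + 1)) (alpha (k + 1)) (δ / C.rounds ε)
        (fun i => s (O.samplesUpTo C ε δ k + i)) (u k) := by
  rw [← O.state_snd C ε δ w₁ s u k]
  rfl

theorem measurable_state_fst (k : ℕ) :
    Measurable fun ω : (ℕ → Sample d) × (ℕ → Ω) => (O.state C ε δ w₁ ω.1 ω.2 k).1 := by
  induction k with
  | zero => exact measurable_const
  | succ k ih =>
    simp only [state_succ_fst]
    refine (O.measurable_run (C.gamma (k + 1)) (alpha (k + 1)) (δ / C.rounds ε)).comp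
      (ih.prodMk (Measurable.prodMk ?_ ?_))
    · exact measurable_pi_lambda _ fun i => (measurable_pi_apply _).comp measurable_fst
    · exact (measurable_pi_apply k).comp measurable_snd

theorem samplesUpTo_mono {j k : ℕ} (h : j ≤ k) :
    O.samplesUpTo C ε δ j ≤ O.samplesUpTo C ε δ k :=
  Finset.sum_le_sum_of_subset (Finset.Icc_subset_Icc_right h)

/-- The state depends only on the samples and random choices used so far. -/
theorem state_fst_truncate (x : Sample d) (y : Ω) (s : ℕ → Sample d) (u : ℕ → Ω) {j k : ℕ}
    (hjk : j ≤ k) :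
    (O.state C ε δ w₁ (truncate x (O.samplesUpTo C ε δ k) s) (truncate y k u) j).1 =
      (O.state C ε δ w₁ s u j).1 := by
  induction j with
  | zero => rfl
  | succ j ih =>
    rw [state_succ_fst, state_succ_fst, ih (by omega)]
    have h1 : truncate y k u j = u j := if_pos (by omega)
    have h2 : (fun i : Fin (O.samples (C.gamma (j + 1)) (δ / C.rounds ε) (alpha (j + 1))) =>
        truncate x (O.samplesUpTo C ε δ k) s (O.samplesUpTo C ε δ j + i)) =
        fun i : Fin _ => s (O.samplesUpTo C ε δ j + i) := by
      funext i
      refine if_pos (lt_of_lt_of_le ?_ (O.samplesUpTo_mono C ε δ hjk))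
      rw [samplesUpTo, samplesUpTo, Finset.sum_Icc_succ_top (by omega)]
      exact Nat.add_lt_add_left i.2 _
    rw [h1, h2]

/-- The next round is independent of the current vector. -/
theorem lintegral_next_round (D : Measure (Sample d)) [IsProbabilityMeasure D] (Q : Measure Ω)
    [IsProbabilityMeasure Q] (k m : ℕ) {G : UnitVec d × ((Fin m → Sample d) × Ω) → ℝ≥0∞}
    (hG : Measurable G) :
    ∫⁻ ω, G ((O.state C ε δ w₁ ω.1 ω.2 k).1, (fun i => ω.1 (O.samplesUpTo C ε δ k + i), ω.2 k))
        ∂((Measure.infinitePi fun _ : ℕ => D).prod (Measure.infinitePi fun _ : ℕ => Q)) =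
      ∫⁻ ω, ∫⁻ q, G ((O.state C ε δ w₁ ω.1 ω.2 k).1, q)
          ∂((Measure.pi fun _ : Fin m => D).prod Q)
        ∂((Measure.infinitePi fun _ : ℕ => D).prod (Measure.infinitePi fun _ : ℕ => Q)) := by
  obtain ⟨x⟩ : Nonempty (Sample d) := nonempty_of_isProbabilityMeasure D
  obtain ⟨y⟩ : Nonempty Ω := nonempty_of_isProbabilityMeasure Q
  set N := O.samplesUpTo C ε δ k
  have hz : Measurable fun (s : ℕ → Sample d) (i : Fin m) => s (N + i) :=
    measurable_pi_lambda _ fun i => measurable_pi_apply _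
  have key := lintegral_prod_eq_of_indepFun (G := fun p : ((ℕ → Sample d) × (ℕ → Ω)) × ((Fin m → Sample d) × Ω) =>
      G ((O.state C ε δ w₁ p.1.1 p.1.2 k).1, p.2))
    (measurable_truncate x N) hz (measurable_truncate y k) (measurable_pi_apply k)
    (indepFun_truncate_block D x N m) (indepFun_truncate_eval Q y k)
    (hG.comp (((O.measurable_state_fst C ε δ w₁ k).comp measurable_fst).prodMk measurable_snd))
  rw [map_block, Measure.infinitePi_map_eval] at key
  -- Truncating both streams leaves the current vector unchanged, and the truncated streams are
  -- independent of the data of the next round.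
  simpa only [N, O.state_fst_truncate C ε δ w₁ x y _ _ le_rfl] using key

end BandOracle

end Run

/-! ### One round of the algorithm -/

section Round

variable {d : ℕ}

theorem theta_eq_arccos (w w' : UnitVec d) :
    theta w w' = Real.arccos ⟪(w : Space d), (w' : Space d)⟫ := by
  rw [theta, angle, norm_unitVec, norm_unitVec, mul_one, div_one]

theorem measurable_theta_right (w' : UnitVec d) : Measurable fun w : UnitVec d => theta w w' := by
  simp only [theta_eq_arccos]
  have : Continuous fun w : UnitVec d => Real.arccos ⟪(w : Space d), (w' : Space d)⟫ := by
    have := Real.continuous_arccos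
    fun_prop
  exact this.measurable

theorem measurableSet_disagree (w' : UnitVec d) :
    MeasurableSet {q : UnitVec d × Space d | halfspace q.1 q.2 ≠ halfspace w' q.2} := by
  have h1 : MeasurableSet {q : UnitVec d × Space d | 0 ≤ ⟪(q.1 : Space d), q.2⟫} := by
    have : Continuous fun q : UnitVec d × Space d => ⟪(q.1 : Space d), q.2⟫ := by fun_prop
    exact measurableSet_le measurable_const this.measurable
  have h2 : MeasurableSet {q : UnitVec d × Space d | 0 ≤ ⟪(w' : Space d), q.2⟫} := by
    have : Continuous fun q : UnitVec d × Space d => ⟪(w' : Space d), q.2⟫ := by fun_prop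
    exact measurableSet_le measurable_const this.measurable
  convert h1.symmDiff h2 using 1
  ext q
  simp only [halfspace_ne_iff, Set.mem_symmDiff, Set.mem_ofPred_eq]
  tauto

theorem measurableSet_band (w : UnitVec d) (γ : ℝ) :
    MeasurableSet {x : Space d | |⟪(w : Space d), x⟫| ≤ γ} :=
  measurableSet_le (by fun_prop) measurable_const

theorem measurable_disagreement (D : Measure (Sample d)) [SFinite D] (w' : UnitVec d) :
    Measurable fun w : UnitVec d => disagreement D (halfspace w) (halfspace w') := by
  have : MeasurableSet {q : UnitVec d × Sample d |
      halfspace q.1 q.2.1 ≠ halfspace w' q.2.1} := by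
    have hm : Measurable fun q : UnitVec d × Sample d => (q.1, q.2.1) := by fun_prop
    exact hm (measurableSet_disagree w')
  exact (measurable_measure_prodMk_left this).ennreal_toReal

theorem measureReal_fst_apply (D : Measure (Sample d)) {s : Set (Space d)} (hs : MeasurableSet s) :
    D.fst.real s = D.real {p | p.1 ∈ s} :=
  map_measureReal_apply measurable_fst hs

theorem disagreement_eq (D : Measure (Sample d)) (w w' : UnitVec d) :
    disagreement D (halfspace w) (halfspace w') =
      D.fst.real {x | halfspace w x ≠ halfspace w' x} :=
  (measureReal_fst_apply D (measurable_prodMk_left (measurableSet_disagree w'))).symm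

/-- The product form of conditioning also covers a null band, so no positivity is needed. -/
theorem bandDist_real_mul (D : Measure (Sample d)) [IsProbabilityMeasure D] (w : UnitVec d) (γ : ℝ)
    (t : Set (Sample d)) :
    (bandDist D w γ).real t * D.fst.real {x | |⟪(w : Space d), x⟫| ≤ γ} =
      D.real ({p | |⟪(w : Space d), p.1⟫| ≤ γ} ∩ t) := by
  rw [measureReal_fst_apply D (measurableSet_band w γ)]
  have hm : MeasurableSet {p : Sample d | |⟪(w : Space d), p.1⟫| ≤ γ} :=
    measurable_fst (measurableSet_band w γ)
  simp only [Measure.real, bandDist, ← ENNReal.toReal_mul]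
  congr 1
  exact cond_mul_eq_inter hm t D

/-- The wedge bound of valid constants extends to `α = π / 2`. -/
theorem Constants.Valid.wedge_le {C : Constants} (hC : C.Valid) {P : Measure (Space d)}
    (hP : IsIsotropicLogConcave P) {w w' : UnitVec d} {α : ℝ} (hα0 : 0 < α)
    (h : theta w w' ≤ α) (hα : α ≤ Real.pi / 2) :
    P.real {x | C.C3' * α ≤ |⟪(w : Space d), x⟫| ∧ halfspace w x ≠ halfspace w' x}
      ≤ α * (C.C1l / 8) := by
  have := hP.isProbabilityMeasure
  have hc := hC.C1l_pos
  have hc3 := hC.C3'_pos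
  rcases hα.lt_or_eq with hlt | heq
  · exact hC.wedge d P hP w w' α h hlt
  -- `α = π / 2` is the first round's value and is excluded from `wedge`. A strictly smaller angle
  -- may serve as its own `α`; only orthogonal vectors need approximation.
  rcases h.lt_or_eq with hθ | hθ
  · have h0 := theta_nonneg w w'
    calc _ ≤ P.real {x | C.C3' * theta w w' ≤ |⟪(w : Space d), x⟫| ∧
          halfspace w x ≠ halfspace w' x} := by
          refine measureReal_mono fun x hx => ⟨le_trans ?_ hx.1, hx.2⟩
          gcongr
      _ ≤ theta w w' * (C.C1l / 8) := hC.wedge d P hP w w' _ le_rfl (by linarith)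
      _ ≤ _ := by gcongr
  rw [heq] at hθ ⊢
  have hww' : ⟪(w : Space d), (w' : Space d)⟫ = 0 := by rw [← cos_theta, hθ, Real.cos_pi_div_two]
  -- Rotating `w'` towards `w` by `η` gives `w''` at angle `π / 2 - η` from `w`, where `wedge`
  -- applies. Replacing `w'` by `w''` costs at most `C1u * η`, and then `η` tends to zero.
  have approx : ∀ η, 0 < η → η < Real.pi / 2 →
      P.real {x | C.C3' * (Real.pi / 2) ≤ |⟪(w : Space d), x⟫| ∧
        halfspace w x ≠ halfspace w' x} ≤ Real.pi / 2 * (C.C1l / 8) + C.C1u * η := by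
    intro η hη hη2
    set v : Space d := Real.sin η • (w : Space d) + Real.cos η • (w' : Space d) with hv
    have hvn : ‖v‖ = 1 := by
      have : ‖v‖ ^ 2 = 1 := by
        rw [hv, norm_add_sq_real, real_inner_smul_left, real_inner_smul_right, hww', norm_smul,
          norm_smul, norm_unitVec, norm_unitVec, Real.norm_eq_abs, Real.norm_eq_abs, mul_one,
          mul_one, sq_abs, sq_abs]
        linarith [Real.sin_sq_add_cos_sq η]
      nlinarith [norm_nonneg v]
    let w'' : UnitVec d := ⟨v, by simp [hvn]⟩
    have hθ1 : theta w w'' = Real.pi / 2 - η := by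
      have : ⟪(w : Space d), (w'' : Space d)⟫ = Real.cos (Real.pi / 2 - η) := by
        change ⟪(w : Space d), v⟫ = _
        rw [hv, inner_add_right, real_inner_smul_right, real_inner_smul_right, hww',
          real_inner_self_eq_norm_sq, norm_unitVec, Real.cos_pi_div_two_sub]
        ring
      rw [theta_eq_arccos, this, Real.arccos_cos] <;> linarith
    have hθ2 : theta w'' w' = η := by
      have : ⟪(w'' : Space d), (w' : Space d)⟫ = Real.cos η := by
        change ⟪v, (w' : Space d)⟫ = _
        rw [hv, inner_add_left, real_inner_smul_left, real_inner_smul_left, hww',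
          real_inner_self_eq_norm_sq, norm_unitVec]
        ring
      rw [theta_eq_arccos, this, Real.arccos_cos] <;> linarith
    calc _ ≤ P.real ({x | C.C3' * (Real.pi / 2 - η) ≤ |⟪(w : Space d), x⟫| ∧
          halfspace w x ≠ halfspace w'' x} ∪ {x | halfspace w'' x ≠ halfspace w' x}) := by
          refine measureReal_mono fun x hx => ?_
          by_cases h1 : halfspace w'' x = halfspace w' x
          · refine Or.inl ⟨le_trans ?_ hx.1, h1 ▸ hx.2⟩
            gcongr
            linarith
          · exact Or.inr h1
      _ ≤ (Real.pi / 2 - η) * (C.C1l / 8) + C.C1u * theta w'' w' :=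
          (measureReal_union_le _ _).trans (add_le_add
            (hC.wedge d P hP w w'' _ hθ1.le (by linarith)) (hC.angle_upper d P hP w'' w'))
      _ ≤ _ := by
          rw [hθ2]
          gcongr
          linarith
  have hu := hC.C1u_pos
  have hpi := Real.pi_pos
  refine le_of_forall_pos_le_add fun e he => ?_
  refine (approx (min (e / C.C1u) (Real.pi / 4)) (by positivity)
    ((min_le_right _ _).trans_lt (by linarith))).trans ?_
  gcongr
  calc C.C1u * min (e / C.C1u) (Real.pi / 4) ≤ C.C1u * (e / C.C1u) := by
        gcongr; exact min_le_left _ _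
    _ = e := by field_simp

/-- This is the in-band share of the disagreement budget. Each alternative in the maximum `cGamma`
is matched by one of the two entries of the minimum `c0`. -/
theorem Constants.Valid.c0_mul_le {C : Constants} (hC : C.Valid) :
    C.c0 * (C.C2u * C.cGamma) ≤ C.C1l / 4 := by
  have h1 := hC.C1l_pos
  have h2 := hC.C2u_pos
  have h3 := hC.C3'_pos
  rcases max_choice C.C3' (C.C1l / C.C2u) with h | h
  · rw [Constants.cGamma, h]
    calc C.c0 * (C.C2u * C.C3') ≤ C.C1l / (4 * C.C2u * C.C3') * (C.C2u * C.C3') := by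
          gcongr; exact min_le_right _ _
      _ = _ := by field_simp
  · rw [Constants.cGamma, h]
    calc C.c0 * (C.C2u * (C.C1l / C.C2u)) ≤ 1 / 4 * (C.C2u * (C.C1l / C.C2u)) := by
          gcongr; exact min_le_left _ _
      _ = _ := by field_simp

theorem Constants.Valid.cGamma_pos {C : Constants} (hC : C.Valid) : 0 < C.cGamma :=
  lt_max_of_lt_left hC.C3'_pos

/-- A vector that nearly agrees with the target in the band has half the angle to it. -/
theorem Constants.Valid.theta_le_half {C : Constants} (hC : C.Valid) {D : Measure (Sample d)}
    [IsProbabilityMeasure D] (hD : IsIsotropicLogConcave D.fst) {w w' wstar : UnitVec d} {α : ℝ}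
    (hα0 : 0 < α) (hα : α ≤ Real.pi / 2) (hw : theta w wstar ≤ α) (hw' : theta w' w ≤ α)
    (hdis : disagreement (bandDist D w (α * C.cGamma)) (halfspace w') (halfspace wstar) ≤ C.c0) :
    theta w' wstar ≤ α / 2 := by
  have h1 := hC.C1l_pos
  have h2 := hC.C2u_pos
  have hγ := hC.cGamma_pos
  have h3 : C.C3' ≤ C.cGamma := le_max_left _ _
  set γ := α * C.cGamma with hγdef
  -- Outside the band, if `w'` and `wstar` disagree then one of them disagrees with `w`. The three
  -- terms are at most `C1l * α / 4`, `C1l * α / 8` and `C1l * α / 8`.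
  have hsplit : D.fst.real {x | halfspace w' x ≠ halfspace wstar x} ≤
      D.fst.real ({x | |⟪(w : Space d), x⟫| ≤ γ} ∩ {x | halfspace w' x ≠ halfspace wstar x}) +
      (D.fst.real {x | C.C3' * α ≤ |⟪(w : Space d), x⟫| ∧ halfspace w x ≠ halfspace w' x} +
       D.fst.real {x | C.C3' * α ≤ |⟪(w : Space d), x⟫| ∧
        halfspace w x ≠ halfspace wstar x}) := by
    refine le_trans (measureReal_mono fun x hx => ?_) ((measureReal_union_le _ _).trans
      (add_le_add le_rfl (measureReal_union_le _ _)))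
    rcases le_or_gt |⟪(w : Space d), x⟫| γ with hb | hb
    · exact Or.inl ⟨hb, hx⟩
    · have hb' : C.C3' * α ≤ |⟪(w : Space d), x⟫| := by
        refine le_trans ?_ hb.le
        rw [hγdef, mul_comm]
        gcongr
      by_cases hxw : halfspace w x = halfspace w' x
      · exact Or.inr (Or.inr ⟨hb', fun h => hx (hxw.symm.trans h)⟩)
      · exact Or.inr (Or.inl ⟨hb', hxw⟩)
  have hin : D.fst.real ({x | |⟪(w : Space d), x⟫| ≤ γ} ∩
      {x | halfspace w' x ≠ halfspace wstar x}) ≤ C.C1l / 4 * α := by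
    have hA : MeasurableSet {x | halfspace w' x ≠ halfspace wstar x} :=
      measurable_prodMk_left (measurableSet_disagree wstar)
    rw [measureReal_fst_apply D ((measurableSet_band w γ).inter hA)]
    have e := bandDist_real_mul D w γ {p | halfspace w' p.1 ≠ halfspace wstar p.1}
    calc _ = disagreement (bandDist D w γ) (halfspace w') (halfspace wstar) *
          D.fst.real {x | |⟪(w : Space d), x⟫| ≤ γ} := e.symm
      _ ≤ C.c0 * (C.C2u * γ) :=
          mul_le_mul hdis (hC.band_upper d _ hD w γ (by positivity)) measureReal_nonneg
            (measureReal_nonneg.trans hdis)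
      _ = C.c0 * (C.C2u * C.cGamma) * α := by rw [hγdef]; ring
      _ ≤ _ := by gcongr; exact hC.c0_mul_le
  have hw1 := hC.wedge_le hD hα0 ((theta_comm w w').trans_le hw') hα
  have hw2 := hC.wedge_le hD hα0 hw hα
  have hlow := hC.angle_lower d _ hD w' wstar
  have : C.C1l * theta w' wstar ≤ C.C1l * (α / 2) := by linarith
  exact le_of_mul_le_mul_left this h1

/-- The error of the target in a band. -/
theorem Constants.Valid.err_bandDist_le {C : Constants} (hC : C.Valid) {D : Measure (Sample d)}
    [IsProbabilityMeasure D] (hD : IsIsotropicLogConcave D.fst) {γ tol : ℝ} (hγ : 0 < γ)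
    {f : Space d → ℤˣ} (h : err D f ≤ tol * (C.C2l * min γ 1)) (w : UnitVec d) :
    err (bandDist D w γ) f ≤ tol := by
  have h2 := hC.C2l_pos
  -- The lower band bound is available only up to width one, so wider bands are shrunk to `min γ 1`.
  have hlow : C.C2l * min γ 1 ≤ D.fst.real {x | |⟪(w : Space d), x⟫| ≤ γ} := by
    refine (hC.band_lower d _ hD w (min γ 1) (by positivity) (min_le_right _ _)).trans ?_
    have := hD.isProbabilityMeasure
    exact measureReal_mono fun x (hx : |⟪(w : Space d), x⟫| ≤ min γ 1) =>
      show |⟪(w : Space d), x⟫| ≤ γ from hx.trans (min_le_left _ _)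
  have e := bandDist_real_mul D w γ {p | p.2 ≠ f p.1}
  have e2 : D.real ({p | |⟪(w : Space d), p.1⟫| ≤ γ} ∩ {p | p.2 ≠ f p.1}) ≤ err D f :=
    measureReal_mono Set.inter_subset_right
  have hpos : 0 < C.C2l * min γ 1 := by positivity
  have h3 : err (bandDist D w γ) f * (C.C2l * min γ 1) ≤ tol * (C.C2l * min γ 1) := by
    refine le_trans ?_ (e.trans_le (e2.trans h))
    exact mul_le_mul_of_nonneg_left hlow measureReal_nonneg
  exact le_of_mul_le_mul_right h3 hpos

theorem alpha_pos (k : ℕ) : 0 < alpha k := div_pos Real.pi_pos (by positivity)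

theorem alpha_succ (k : ℕ) : alpha (k + 1) = alpha k / 2 := by
  rw [alpha, alpha, pow_succ]; ring

theorem alpha_anti {j k : ℕ} (h : j ≤ k) : alpha k ≤ alpha j := by
  have := Real.pi_pos
  unfold alpha
  gcongr
  norm_num

theorem alpha_one : alpha 1 = Real.pi / 2 := by rw [alpha, pow_one]

/-- The returned vector has index `rounds + 1`, which offsets the `- 1` in `rounds`; with truncated
subtraction this also covers zero rounds. -/
theorem Constants.mul_alpha_rounds_succ_le {C : Constants} (hC : 0 < C.C1u) {ε : ℝ} (hε : 0 < ε) :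
    C.C1u * alpha (C.rounds ε + 1) ≤ ε := by
  have hpi := Real.pi_pos
  have hL : Real.logb 2 (C.C1u * Real.pi / ε) ≤ ((C.rounds ε + 1 : ℕ) : ℝ) :=
    (Nat.le_ceil _).trans (by exact_mod_cast (by unfold Constants.rounds; omega))
  rw [Real.logb_le_iff_le_rpow one_lt_two (by positivity), Real.rpow_natCast,
    div_le_iff₀ hε] at hL
  rw [alpha, mul_div_assoc', div_le_iff₀ (by positivity)]
  linarith

/-- No executed round is too fine: the bands stay wide compared with `ε`, hence with `opt`, which
secures the oracle's precondition. -/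
theorem Constants.lt_mul_alpha_of_le_rounds {C : Constants} (hC : 0 < C.C1u) {ε : ℝ} (hε : 0 < ε)
    {k : ℕ} (h1 : 1 ≤ k) (hk : k ≤ C.rounds ε) : ε < C.C1u * alpha k := by
  have hpi := Real.pi_pos
  have hL : (k : ℝ) < Real.logb 2 (C.C1u * Real.pi / ε) :=
    Nat.lt_ceil.1 (by unfold Constants.rounds at hk; omega)
  rw [Real.lt_logb_iff_rpow_lt one_lt_two (by positivity), Real.rpow_natCast, lt_div_iff₀ hε] at hL
  rw [alpha, mul_div_assoc', lt_div_iff₀ (by positivity)]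
  linarith

/-- A round fails with small probability. -/
theorem BandOracle.measureReal_round_fails_le {Ω : Type*} [MeasurableSpace Ω] {C : Constants}
    (hC : C.Valid) {D : Measure (Sample d)} [IsProbabilityMeasure D]
    (hD : IsIsotropicLogConcave D.fst) {Q : Measure Ω} [IsProbabilityMeasure Q]
    (O : BandOracle d Ω) {wstar w₁ : UnitVec d} {ε δ tol : ℝ} (hδ : 0 < δ) (k : ℕ)
    (hspec : ∀ (s : ℕ → Sample d) (u : ℕ → Ω),
      O.MeetsSpec D Q wstar C.c0 tol (O.state C ε δ w₁ s u k).1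
        (C.gamma (k + 1)) (alpha (k + 1)) (δ / C.rounds ε))
    (herr : ∀ w, err (bandDist D w (C.gamma (k + 1))) (halfspace wstar) ≤ tol) :
    ((Measure.infinitePi fun _ : ℕ => D).prod (Measure.infinitePi fun _ : ℕ => Q)).real
      {ω | theta (O.state C ε δ w₁ ω.1 ω.2 k).1 wstar ≤ alpha (k + 1) ∧
        ¬ theta (O.state C ε δ w₁ ω.1 ω.2 (k + 1)).1 wstar ≤ alpha (k + 2)} ≤ δ / C.rounds ε := by
  have hδ' : 0 ≤ δ / C.rounds ε := by positivity
  set m := O.samples (C.gamma (k + 1)) (δ / C.rounds ε) (alpha (k + 1)) with hm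
  have hrun := O.measurable_run (C.gamma (k + 1)) (alpha (k + 1)) (δ / C.rounds ε)
  -- Failure is expressed through the current vector and the fresh data, so that the vector can be
  -- frozen and the specification applied to each section of `B`.
  set B : Set (UnitVec d × ((Fin m → Sample d) × Ω)) :=
    {p | theta p.1 wstar ≤ alpha (k + 1) ∧ ¬ theta (O.run p.1 (C.gamma (k + 1)) (alpha (k + 1))
      (δ / C.rounds ε) p.2.1 p.2.2) wstar ≤ alpha (k + 2)} with hB
  have hBm : MeasurableSet B :=
    (measurableSet_le ((measurable_theta_right wstar).comp measurable_fst) measurable_const).inter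
      (measurableSet_le ((measurable_theta_right wstar).comp hrun) measurable_const).compl
  refine ENNReal.toReal_le_of_le_ofReal hδ' ?_
  have hstate := O.measurable_state_fst C ε δ w₁ k
  set W := fun ω : (ℕ → Sample d) × (ℕ → Ω) => ((O.state C ε δ w₁ ω.1 ω.2 k).1,
    ((fun i : Fin m => ω.1 (O.samplesUpTo C ε δ k + i)), ω.2 k)) with hW
  have hWm : Measurable W := by
    refine hstate.prodMk (Measurable.prodMk ?_ ((measurable_pi_apply k).comp measurable_snd))
    exact measurable_pi_lambda _ fun i => (measurable_pi_apply _).comp measurable_fst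
  have hset : {ω : (ℕ → Sample d) × (ℕ → Ω) |
      theta (O.state C ε δ w₁ ω.1 ω.2 k).1 wstar ≤ alpha (k + 1) ∧
        ¬ theta (O.state C ε δ w₁ ω.1 ω.2 (k + 1)).1 wstar ≤ alpha (k + 2)} = W ⁻¹' B := by
    ext ω
    simp only [Set.mem_ofPred_eq, Set.mem_preimage, hB, hW, O.state_succ_fst C ε δ w₁]
    rfl
  rw [hset, ← lintegral_indicator_one (hWm hBm)]
  have key := O.lintegral_next_round C ε δ w₁ D Q k m (G := B.indicator 1)
    (measurable_one.indicator hBm)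
  refine (key.trans_le (lintegral_mono (g := fun _ => ENNReal.ofReal (δ / C.rounds ε))
    fun ω => ?_)).trans_eq ?_
  · set w := (O.state C ε δ w₁ ω.1 ω.2 k).1 with hw
    have hsec : MeasurableSet {q | (w, q) ∈ B} := measurable_prodMk_left hBm
    have e : ∫⁻ q, B.indicator 1 (w, q) ∂((Measure.pi fun _ : Fin m => D).prod Q) =
        ((Measure.pi fun _ : Fin m => D).prod Q) {q | (w, q) ∈ B} :=
      lintegral_indicator_one hsec
    change ∫⁻ q, B.indicator 1 (w, q) ∂((Measure.pi fun _ : Fin m => D).prod Q) ≤ _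
    rw [e]
    by_cases hθ : theta w wstar ≤ alpha (k + 1)
    · obtain ⟨hae, hprob⟩ := hspec ω.1 ω.2 hθ (herr _)
      set good := {q : (Fin m → Sample d) × Ω | disagreement (bandDist D w (C.gamma (k + 1)))
        (halfspace (O.run w (C.gamma (k + 1)) (alpha (k + 1)) (δ / C.rounds ε) q.1 q.2))
        (halfspace wstar) ≤ C.c0} with hgood
      have hgm : MeasurableSet good := by
        have : SFinite (bandDist D w (C.gamma (k + 1))) := by unfold bandDist; infer_instance
        exact measurableSet_le ((measurable_disagreement _ wstar).comp
          (hrun.comp measurable_prodMk_left)) measurable_const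
      have hcompl := probReal_compl_eq_one_sub (μ := (Measure.pi fun _ : Fin m => D).prod Q) hgm
      -- The angle to `w` is controlled almost surely, so on `good` the halving lemma excludes
      -- failure up to a null set.
      calc _ ≤ ((Measure.pi fun _ : Fin m => D).prod Q) goodᶜ := by
            refine measure_mono_ae ?_
            filter_upwards [hae] with q hq hqB
            by_contra hqg
            have hqg' : q ∈ good := by
              by_contra h
              exact hqg h
            refine hqB.2 ?_
            rw [alpha_succ (k + 1)]
            refine hC.theta_le_half hD (alpha_pos _) ?_ hθ hq hqg'
            rw [← alpha_one]
            exact alpha_anti (by omega)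
        _ = ENNReal.ofReal (((Measure.pi fun _ : Fin m => D).prod Q).real goodᶜ) :=
            (ofReal_measureReal (by finiteness)).symm
        _ ≤ _ := ENNReal.ofReal_le_ofReal (by rw [hcompl]; linarith)
    · have : {q | (w, q) ∈ B} = ∅ := by
        ext q
        simp [hB, hθ]
      rw [this, measure_empty]
      exact zero_le
  · rw [lintegral_const, measure_univ, mul_one]

end Round

end Localization

/-! ### Assembly of the rounds -/

theorem mainTheorem3 :
    (∃ C : Constants, C.Valid) ∧
    ∀ C : Constants, C.Valid → ∀ g : ℝ → ℝ, 0 < g C.c0 →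
      ∃ c : ℝ, 0 < c ∧
        ∀ (d : ℕ) (D : Measure (Sample d)) [IsProbabilityMeasure D],
          IsIsotropicLogConcave D.fst →
        ∀ wstar : UnitVec d, err D (halfspace wstar) = opt D →
        ∀ ε δ : ℝ, 0 < ε → c * opt D ≤ ε → 0 < δ →
        ∀ w₁ : UnitVec d, theta w₁ wstar < Real.pi / 2 →
        ∀ (Ω : Type*) [MeasurableSpace Ω] (Q : Measure Ω) [IsProbabilityMeasure Q]
          (O : BandOracle d Ω),
          (∀ k ∈ Finset.Icc 1 (C.rounds ε), ∀ (s : ℕ → Sample d) (u : ℕ → Ω),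
            O.MeetsSpec D Q wstar C.c0 (g C.c0) (O.iterate C ε δ w₁ s u k)
              (C.gamma k) (alpha k) (δ / C.rounds ε)) →
          (∀ (s : ℕ → Sample d) (u : ℕ → Ω),
            O.samplesTaken C ε δ w₁ s u =
              ∑ k ∈ Finset.Icc 1 (C.rounds ε),
                O.samples (C.gamma k) (δ / C.rounds ε) (alpha k)) ∧
          1 - δ ≤ ((Measure.infinitePi fun _ : ℕ => D).prod
              (Measure.infinitePi fun _ : ℕ => Q)).real
            {ω | (∀ k ∈ Finset.Icc 1 (C.rounds ε + 1),
                  theta (O.iterate C ε δ w₁ ω.1 ω.2 k) wstar ≤ alpha k) ∧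
                err D (halfspace (O.output C ε δ w₁ ω.1 ω.2)) ≤ opt D + ε} := by
  refine ⟨exists_valid_constants, fun C hC g hg => ?_⟩
  have hu := hC.C1u_pos
  have hl := hC.C2l_pos
  have hγ := hC.cGamma_pos
  have hpi := Real.pi_pos
  -- Chosen so that `ε * κ ≤ min γ_k 1` in every executed round, from `ε < C1u * α_k` and `α_k ≤ π`.
  -- With `c = 1 / (g c₀ * C2l * κ)`, `c * opt ≤ ε` becomes the error bound required by
  -- `err_bandDist_le`.
  set κ := min (C.cGamma / C.C1u) (1 / (C.C1u * Real.pi)) with hκ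
  have hκ0 : 0 < κ := by positivity
  refine ⟨1 / (g C.c0 * C.C2l * κ), by positivity, ?_⟩
  intro d D _ hD wstar hopt ε δ hε hoptε hδ w₁ hw₁ Ω _ Q _ O hO
  refine ⟨fun s u => O.state_snd C ε δ w₁ s u _, ?_⟩
  have herr : ∀ k, k + 1 ≤ C.rounds ε → ∀ w,
      err (bandDist D w (C.gamma (k + 1))) (halfspace wstar) ≤ g C.c0 := by
    intro k hk w
    have hα := C.lt_mul_alpha_of_le_rounds hu hε (by omega) hk
    have hαpos := alpha_pos (k + 1)
    refine hC.err_bandDist_le hD (mul_pos hαpos hγ) ?_ w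
    have hmin : ε * κ ≤ min (C.gamma (k + 1)) 1 := by
      refine le_min ?_ ?_
      · calc ε * κ ≤ C.C1u * alpha (k + 1) * (C.cGamma / C.C1u) := by
              gcongr; exact min_le_left _ _
          _ = C.gamma (k + 1) := by unfold Constants.gamma; field_simp
      · have hle : alpha (k + 1) ≤ Real.pi := div_le_self hpi.le (one_le_pow₀ (by norm_num))
        calc ε * κ ≤ C.C1u * Real.pi * (1 / (C.C1u * Real.pi)) := by
              gcongr
              · exact hα.le.trans (by gcongr)
              · exact min_le_right _ _
          _ = 1 := by field_simp
    rw [hopt]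
    have h1 : opt D ≤ g C.c0 * C.C2l * (ε * κ) := by
      rw [div_mul_eq_mul_div, one_mul, div_le_iff₀ (by positivity)] at hoptε
      linarith
    calc opt D ≤ g C.c0 * C.C2l * (ε * κ) := h1
      _ ≤ g C.c0 * C.C2l * min (C.gamma (k + 1)) 1 := by gcongr
      _ = _ := by rw [mul_assoc]; rfl
  set μ := (Measure.infinitePi fun _ : ℕ => D).prod (Measure.infinitePi fun _ : ℕ => Q) with hμ
  set bad : ℕ → Set ((ℕ → Sample d) × (ℕ → Ω)) := fun k =>
    {ω | theta (O.state C ε δ w₁ ω.1 ω.2 k).1 wstar ≤ alpha (k + 1) ∧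
      ¬ theta (O.state C ε δ w₁ ω.1 ω.2 (k + 1)).1 wstar ≤ alpha (k + 2)} with hbad
  have hbadle : ∀ k ∈ Finset.range (C.rounds ε), μ.real (bad k) ≤ δ / C.rounds ε := by
    intro k hk
    have hk' : k + 1 ≤ C.rounds ε := Finset.mem_range.1 hk
    exact O.measureReal_round_fails_le hC hD hδ k
      (fun s u => hO (k + 1) (Finset.mem_Icc.2 ⟨by omega, hk'⟩) s u) (herr k hk')
  set good := {ω : (ℕ → Sample d) × (ℕ → Ω) |
    (∀ k ∈ Finset.Icc 1 (C.rounds ε + 1),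
      theta (O.iterate C ε δ w₁ ω.1 ω.2 k) wstar ≤ alpha k) ∧
    err D (halfspace (O.output C ε δ w₁ ω.1 ω.2)) ≤ opt D + ε} with hgood
  have hcover : Set.univ ⊆ good ∪ ⋃ k ∈ Finset.range (C.rounds ε), bad k := by
    intro ω _
    by_cases hω : ω ∈ ⋃ k ∈ Finset.range (C.rounds ε), bad k
    · exact Or.inr hω
    refine Or.inl ?_
    -- The state after `k` rounds is `w_{k+1}`, hence the shifted bound; the start is `θ(w₁, w*) < π
    -- / 2 = α₁`.
    have hind : ∀ k, k ≤ C.rounds ε →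
        theta (O.state C ε δ w₁ ω.1 ω.2 k).1 wstar ≤ alpha (k + 1) := by
      intro k
      induction k with
      | zero => intro _; rw [zero_add, alpha_one]; exact hw₁.le
      | succ k ih =>
        intro hk
        by_contra hcon
        exact hω (Set.mem_biUnion (Finset.mem_coe.2 (Finset.mem_range.2 hk)) ⟨ih (by omega), hcon⟩)
    refine ⟨fun k hk => ?_, ?_⟩
    · obtain ⟨hk1, hk2⟩ := Finset.mem_Icc.1 hk
      obtain ⟨j, rfl⟩ : ∃ j, k = j + 1 := ⟨k - 1, by omega⟩
      exact hind j (by omega)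
    · have hlast := hind (C.rounds ε) le_rfl
      set v := O.output C ε δ w₁ ω.1 ω.2 with hv
      have hdis : D.real {p | halfspace v p.1 ≠ halfspace wstar p.1} ≤ ε :=
        calc disagreement D (halfspace v) (halfspace wstar)
            = D.fst.real {x | halfspace v x ≠ halfspace wstar x} := disagreement_eq D v wstar
          _ ≤ C.C1u * theta v wstar := hC.angle_upper d _ hD v wstar
          _ ≤ C.C1u * alpha (C.rounds ε + 1) := by gcongr; exact hlast
          _ ≤ ε := Constants.mul_alpha_rounds_succ_le hu hε
      calc err D (halfspace v) ≤ D.real ({p | p.2 ≠ halfspace wstar p.1} ∪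
            {p | halfspace v p.1 ≠ halfspace wstar p.1}) := by
            refine measureReal_mono fun p hp => ?_
            by_cases h : halfspace v p.1 = halfspace wstar p.1
            · exact Or.inl fun h' => hp (h'.trans h.symm)
            · exact Or.inr h
        _ ≤ err D (halfspace wstar) + ε := (measureReal_union_le _ _).trans (add_le_add le_rfl hdis)
        _ = opt D + ε := by rw [hopt]
  have htotal : (1 : ℝ) ≤ μ.real good + C.rounds ε * (δ / C.rounds ε) := by
    calc (1 : ℝ) = μ.real Set.univ := probReal_univ.symm
      _ ≤ μ.real good + μ.real (⋃ k ∈ Finset.range (C.rounds ε), bad k) :=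
          (measureReal_mono hcover).trans (measureReal_union_le _ _)
      _ ≤ μ.real good + ∑ k ∈ Finset.range (C.rounds ε), μ.real (bad k) := by
          gcongr; exact measureReal_biUnion_finset_le _ _
      _ ≤ μ.real good + ∑ _k ∈ Finset.range (C.rounds ε), δ / C.rounds ε := by
          gcongr with k hk; exact hbadle k hk
      _ = _ := by rw [Finset.sum_const, Finset.card_range, nsmul_eq_mul]
  -- With zero rounds the quotient is `0` by convention, so only an inequality holds.
  have hδr : (C.rounds ε : ℝ) * (δ / C.rounds ε) ≤ δ := by
    rcases Nat.eq_zero_or_pos (C.rounds ε) with h | h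
    · simp [h, hδ.le]
    · have : (0 : ℝ) < C.rounds ε := by exact_mod_cast h
      exact (mul_div_cancel₀ δ this.ne').le
  linarith
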